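/- For a finite graph $G$ and an integer $k\ge 1$, Maker and Breaker alternately (Maker first) choose an uncolored vertex of $G$ and give it one of $k$ colors so that adjacent vertices never have the same color. Breaker wins if at some point an uncolored vertex has all $k$ colors in its neighborhood; Maker wins if all vertices are eventually colored. The game chromatic number $\chi_g(G)$ is the least $k\ge 1$ for which Maker has a winning strategy. Let $B_{n,p}$ be the random bipartite graph with two parts of $n$ vertices, in which each of the $n^2$ possible edges is present independently with probability $p$. Let $\eta>0$ be a constant, let $p=p(n)\le 1-\eta$, and put $b=\frac1{1-p}$. Write $\log$ for the natural logarithm; "whp" means with probability tending to $1$ as $n\to\infty$. **(a)** If $p\ge 2/n$ for all sufficiently large $n$, then whp $$\chi_g(B_{n,p})\ \ge\ \frac{n}{10\,(\log n)\,(\log_b np)}.$$ **(b)** If $\alpha>2$ is a constant, $K=\max\left\{\frac{2\alpha}{\alpha-1},\frac{\alpha}{\alpha-2}\right\}$, and $p\ge (\log n)^K/n$ for all sufficiently large $n$, then whp $$\chi_g(B_{n,p})\ \le\ \alpha\,\frac{n}{\log_b np}.$$ -/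

import Mathlib

open MeasureTheory ProbabilityTheory Filter Topology

namespace ColoringGame

variable {V : Type*} [DecidableEq V] {k : ℕ}

/-- The two players. -/
inductive Player
  | maker
  | breaker

/-- A position of the game with `k` colors: a partial coloring, `none` meaning "uncolored". -/
abbrev Position (V : Type*) (k : ℕ) := V → Option (Fin k)

/-- Assigning color `i` to `v` is a legal move in the position `c`: the vertex `v` is uncolored
and no neighbor of `v` has color `i`, so that the coloring stays proper. -/
def Legal (G : SimpleGraph V) (c : Position V k) (v : V) (i : Fin k) : Prop :=
  c v = none ∧ ∀ w, G.Adj v w → c w ≠ some i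

/-- The position after `v` has been given color `i`. -/
def play (c : Position V k) (v : V) (i : Fin k) : Position V k :=
  Function.update c v (some i)

/-- Some uncolored vertex sees all `k` colors in its neighborhood: Breaker has won. -/
def Stuck (G : SimpleGraph V) (c : Position V k) : Prop :=
  ∃ v, c v = none ∧ ∀ i, ∃ w, G.Adj v w ∧ c w = some i

/-- `MakerWins G t c`: Maker can force that all vertices are eventually colored, when the position
is `c` and it is the turn of `t`. -/
inductive MakerWins (G : SimpleGraph V) : Player → Position V k → Prop
  /-- All vertices are colored. -/
  | finished (t : Player) (c : Position V k) (h : ∀ v, c v ≠ none) : MakerWins G t c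
  /-- Maker has a legal move to a position which is winning for him. -/
  | maker (c : Position V k) (v : V) (i : Fin k) (h : Legal G c v i)
      (hw : MakerWins G .breaker (play c v i)) : MakerWins G .maker c
  /-- Breaker has not won, and each of his legal moves leads to a position which is winning for
  Maker. -/
  | breaker (c : Position V k) (h : ¬ Stuck G c)
      (hw : ∀ v i, Legal G c v i → MakerWins G .maker (play c v i)) : MakerWins G .breaker c

/-- The game chromatic number: the least positive number `k` of colors for which Maker, moving
first from the uncolored graph, has a winning strategy. -/
noncomputable def gameChromaticNumber (G : SimpleGraph V) : ℕ :=
  sInf {k : ℕ | 0 < k ∧ MakerWins G .maker (fun _ => none : Position V k)}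

/-- With more colors than vertices Maker wins from every position. -/
theorem makerWins_of_card_lt [Fintype V] (G : SimpleGraph V) (hk : Fintype.card V < k)
    (m : ℕ) : ∀ (t : Player) (c : Position V k),
      (Finset.univ.filter fun v => c v = none).card = m → MakerWins G t c := by
  classical
  have avail : ∀ (c : Position V k), ∃ i : Fin k, ∀ w, c w ≠ some i := by
    intro c
    by_contra! hcon
    choose f hf using hcon
    have hinj : Function.Injective f := by
      intro a b hab
      have h1 := hf a
      rw [hab, hf b] at h1
      exact (Option.some.inj h1).symm
    have := Fintype.card_le_of_injective f hinj
    simp only [Fintype.card_fin] at this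
    omega
  have step : ∀ (c : Position V k) (v : V) (i : Fin k), c v = none →
      (Finset.univ.filter fun w => play c v i w = none).card + 1
        = (Finset.univ.filter fun w => c w = none).card := by
    intro c v i hv
    have : (Finset.univ.filter fun w => play c v i w = none)
        = (Finset.univ.filter fun w => c w = none).erase v := by
      ext w
      rw [Finset.mem_erase, Finset.mem_filter, Finset.mem_filter]
      by_cases hw : w = v
      · subst hw; simp [play]
      · simp [play, hw]
    rw [this]
    exact Finset.card_erase_add_one (by simp [hv])
  induction m with
  | zero =>
    intro t c hc
    refine MakerWins.finished t c fun v hv => ?_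
    have : v ∈ (Finset.univ.filter fun w => c w = none) := by simp [hv]
    rw [Finset.card_eq_zero.mp hc] at this
    simp at this
  | succ m ih =>
    intro t c hc
    cases t with
    | maker =>
      obtain ⟨v, hv⟩ := Finset.card_pos.mp (show 0 < _ by rw [hc]; omega)
      simp only [Finset.mem_filter, Finset.mem_univ, true_and] at hv
      obtain ⟨i, hi⟩ := avail c
      exact MakerWins.maker c v i ⟨hv, fun w _ => hi w⟩
        (ih _ _ (by have := step c v i hv; omega))
    | breaker =>
      refine MakerWins.breaker c ?_ fun v i h => ih _ _ (by have := step c v i h.1; omega)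
      rintro ⟨v, -, h⟩
      obtain ⟨i, hi⟩ := avail c
      obtain ⟨w, -, hw⟩ := h i
      exact hi w hw

/-- On a finite graph the game chromatic number is well defined: it is a positive number of colors
with which Maker wins. -/
theorem gameChromaticNumber_spec [Fintype V] (G : SimpleGraph V) :
    0 < gameChromaticNumber G ∧
      MakerWins G .maker (fun _ => none : Position V (gameChromaticNumber G)) :=
  Nat.sInf_mem (s := {k : ℕ | 0 < k ∧ MakerWins G .maker (fun _ => none : Position V k)})
    ⟨Fintype.card V + 1, Nat.succ_pos _,
      makerWins_of_card_lt G (Nat.lt_succ_self _) _ _ _ rfl⟩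

end ColoringGame

namespace RandomBipartite

/-- The bipartite graph with two parts of size `n` in which the `i`-th vertex of the first part is
joined to the `j`-th vertex of the second part iff `(i, j) ∈ E`. -/
def bipartiteGraph {n : ℕ} (E : Set (Fin n × Fin n)) : SimpleGraph (Fin n ⊕ Fin n) where
  Adj
    | .inl i, .inr j => (i, j) ∈ E
    | .inr j, .inl i => (i, j) ∈ E
    | _, _ => False
  symm := ⟨by rintro (i | i) (j | j) h <;> exact h⟩
  loopless := ⟨by rintro (i | i) h <;> exact h⟩

/-- The probability that the random bipartite graph `B_{n,p}` has the property `P`: each of the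
`n ^ 2` possible edges is present independently with probability `p`. -/
noncomputable def prob (n : ℕ) (p : unitInterval) (P : SimpleGraph (Fin n ⊕ Fin n) → Prop) :
    ENNReal :=
  setBernoulli (Set.univ : Set (Fin n × Fin n)) p {E | P (bipartiteGraph E)}

/-- With high probability `B_{n,p(n)}` has the property `P n`. -/
def Whp (p : ℕ → unitInterval) (P : ∀ n : ℕ, SimpleGraph (Fin n ⊕ Fin n) → Prop) : Prop :=
  Tendsto (fun n => prob n (p n) (P n)) atTop (𝓝 1)

/-- `log_b (n p)` with `b = 1 / (1 - p)`. -/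
noncomputable def logbnp (n : ℕ) (p : unitInterval) : ℝ :=
  Real.logb (1 / (1 - (p : ℝ))) ((n : ℝ) * (p : ℝ))

end RandomBipartite

/-!
Each bound comes from an explicit strategy that wins on every bipartite graph with suitable
pseudorandom properties, and from a first moment argument which shows that `B_{n,p}` has these
properties with high probability. Write `q = 1 - p`, and `avail G c v` for the set of colors that do
not occur in the neighborhood of `v` in the partial coloring `c`.

**Upper bound.** Maker always colors a vertex with the fewest available colors. With
`k = α * n / log_b (n * p)` colors, the expected number of available colors at a vertex is at least
`β ≈ k * (n * p) ^ (-1 / α)` for every given partial coloring. Given the coloring, the numbers at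
different vertices of one part are sums over disjoint blocks of edges, so an exponential tail bound
beats the number of colorings: with high probability *every* partial coloring leaves all but few
vertices with at least `β / 2` available colors (`pr_few_available`). Moreover small vertex sets span
few edges (`pr_dense_subset`). Suppose now that Maker loses. After the last time at which all
uncolored vertices have at least `A` available colors, Maker picks only vertices which end up with
fewer than `A` available colors, so the set of vertices that are still to be colored is about twice
as large as the set of such vertices. Since this set spans few edges, most of its vertices lose
only few of their colors. Hence, if `A` is lowered a little, the set of deficient vertices shrinks by
a constant factor. Iterating this, at most `16` vertices remain to be colored while each of them has
`17` available colors, a contradiction (`makerWins_of_sparse`). The assumption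
`n * p ≥ (log n) ^ K` guarantees that `β` exceeds the total amount by which `A` is lowered.

**Lower bound.** Breaker plays only on the first part. He plans to play each color on `t` vertices
there, where `q ^ t` is about `(log g) / g` for `g = n * log (1 / q) / log n`. If Maker plays a color
with which Breaker is not yet done in the second part, then Breaker answers with the same color, so
that Maker's moves can never outnumber his own in the color in question and legal vertices remain.
A color for which there are too few legal vertices nevertheless is given up as bad; pseudorandomness
implies that the bad colors are available at few vertices only. Breaker's choice of vertices keeps a
potential large: the expected number of vertices of the second part that lose all colors which are
not bad, if the missing vertices were chosen at random (`potential`). An average choice would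
preserve it, and by the even distribution of the edges some legal vertex nearly does; the losses form
a geometric series. Initially the potential is `n * (1 - q ^ t) ^ k`, a constant proportion of `n`,
because `k * q ^ t` is bounded for `k` below the claimed bound. So at the end some uncolored vertex
of the second part has no available color (`not_makerWins_of_pseudorandom`). All properties that are
used hold with high probability if `g` is large (`pr_not_pseudorandom_le`), and if it
is not, then the claimed lower bound is at most `1`.
-/

/-! ### Maker's strategy of coloring a vertex with fewest available colors -/

namespace ColoringGame

variable {V : Type*} {k : ℕ}

open Classical in
/-- The colors that do not occur in the neighborhood of `v`. The vertex `v` itself may be colored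
or not. -/
noncomputable def avail (G : SimpleGraph V) (c : Position V k) (v : V) : Finset (Fin k) :=
  Finset.univ.filter fun i => ∀ w, G.Adj v w → c w ≠ some i

/-- `Extends c c'` says that the partial coloring `c'` extends `c`. -/
def Extends (c c' : Position V k) : Prop := ∀ v i, c v = some i → c' v = some i

theorem Extends.trans {c c' c'' : Position V k} (h : Extends c c') (h' : Extends c' c'') :
    Extends c c'' := fun v i hi => h' v i (h v i hi)

theorem Extends.eq_none {c c' : Position V k} (h : Extends c c') {v : V} (hv : c' v = none) :
    c v = none := by
  cases hc : c v with
  | none => rfl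
  | some i => rw [h v i hc] at hv; cases hv

theorem avail_anti (G : SimpleGraph V) {c c' : Position V k} (h : Extends c c') (v : V) :
    avail G c' v ⊆ avail G c v := by
  intro i hi
  simp only [avail, Finset.mem_filter, Finset.mem_univ, true_and] at hi ⊢
  exact fun w hw hc => hi w hw (h w i hc)

variable [DecidableEq V]

theorem extends_play {c : Position V k} {v : V} (hv : c v = none) (i : Fin k) :
    Extends c (play c v i) := by
  intro w j hj
  have : w ≠ v := by rintro rfl; rw [hv] at hj; cases hj
  simp [play, this, hj]

theorem play_self (c : Position V k) (v : V) (i : Fin k) : play c v i v = some i := by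
  simp [play]

variable [Fintype V]

theorem card_uncolored_play {c : Position V k} {v : V} (hv : c v = none) (i : Fin k) :
    (Finset.univ.filter fun w => play c v i w = none).card + 1
      = (Finset.univ.filter fun w => c w = none).card := by
  have : (Finset.univ.filter fun w => play c v i w = none)
      = (Finset.univ.filter fun w => c w = none).erase v := by
    ext w
    rw [Finset.mem_erase, Finset.mem_filter, Finset.mem_filter]
    by_cases hw : w = v
    · subst hw; simp [play]
    · simp [play, hw]
  rw [this]
  exact Finset.card_erase_add_one (by simp [hv])

omit [DecidableEq V] [Fintype V] in
open Classical in
/-- Every color that becomes unavailable at `v` is due to a newly colored neighbor of `v`. -/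
theorem card_avail_le (G : SimpleGraph V) (c c' : Position V k) (v : V) (S : Finset V)
    (hS : ∀ w, c w = none → c' w ≠ none → w ∈ S) (h : Extends c c') :
    (avail G c v).card ≤ (avail G c' v).card + (S.filter fun w => G.Adj v w).card := by
  have hsub : avail G c v \ avail G c' v ⊆
      ((S.filter fun w => G.Adj v w).image c').eraseNone := by
    intro i hi
    simp only [avail, Finset.mem_sdiff, Finset.mem_filter, Finset.mem_univ, true_and,
      not_forall, not_not] at hi
    obtain ⟨h1, w, hw, hcw⟩ := hi
    rw [Finset.mem_eraseNone, Finset.mem_image]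
    refine ⟨w, Finset.mem_filter.2 ⟨hS w ?_ (by simp [hcw]), hw⟩, hcw⟩
    cases hc : c w with
    | none => rfl
    | some j =>
      have := h w j hc
      rw [hcw] at this
      cases this
      exact absurd hc (h1 w hw)
  have h1 := Finset.card_le_card hsub
  have h2 : (((S.filter fun w => G.Adj v w).image c').eraseNone).card ≤
      (S.filter fun w => G.Adj v w).card :=
    (Finset.card_eraseNone_le _).trans Finset.card_image_le
  have h3 := Finset.card_le_card_sdiff_add_card (s := avail G c v) (t := avail G c' v)
  omega

/-- A play of the game lost by Maker, in which he always colors a vertex with the fewest available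
colors. The position before the `r`-th round is `c r`, Maker colors `pick r` in this round, and
after `N` rounds and possibly one more move of Maker the position `F` is reached, in which the
uncolored vertex `d` has no available color. -/
structure LosingRun (G : SimpleGraph V) (c₀ : Position V k) where
  N : ℕ
  c : ℕ → Position V k
  pick : ℕ → V
  F : Position V k
  d : V
  start : c 0 = c₀
  step : ∀ r < N, Extends (c r) (c (r + 1))
  last : Extends (c N) F
  pick_none : ∀ r < N, c r (pick r) = none
  pick_colored : ∀ r < N, c (r + 1) (pick r) ≠ none
  pick_min : ∀ r < N, ∀ v, c r v = none → (avail G (c r) (pick r)).card ≤ (avail G (c r) v).card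
  card_step : ∀ r < N, (Finset.univ.filter fun v => c r v = none).card ≤
    (Finset.univ.filter fun v => c (r + 1) v = none).card + 2
  card_last : (Finset.univ.filter fun v => c N v = none).card ≤
    (Finset.univ.filter fun v => F v = none).card + 1
  dead_none : F d = none
  dead : avail G F d = ∅

/-- A run without complete rounds. -/
def LosingRun.nil {G : SimpleGraph V} {c₀ : Position V k} (F : Position V k) (d : V)
    (h : Extends c₀ F) (hc : (Finset.univ.filter fun v => c₀ v = none).card ≤
      (Finset.univ.filter fun v => F v = none).card + 1) (hd : F d = none)
    (hd' : avail G F d = ∅) : LosingRun G c₀ where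
  N := 0
  c := fun _ => c₀
  pick := fun _ => d
  F := F
  d := d
  start := rfl
  step := by simp
  last := h
  pick_none := by simp
  pick_colored := by simp
  pick_min := by simp
  card_step := by simp
  card_last := hc
  dead_none := hd
  dead := hd'

/-- Prefix a run with one more round. -/
def LosingRun.cons {G : SimpleGraph V} {c₀ c₁ : Position V k} (R : LosingRun G c₁) (v : V)
    (h : Extends c₀ c₁) (hv : c₀ v = none) (hv' : c₁ v ≠ none)
    (hmin : ∀ w, c₀ w = none → (avail G c₀ v).card ≤ (avail G c₀ w).card)
    (hc : (Finset.univ.filter fun v => c₀ v = none).card ≤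
      (Finset.univ.filter fun v => c₁ v = none).card + 2) : LosingRun G c₀ where
  N := R.N + 1
  c := fun r => Nat.casesOn r c₀ R.c
  pick := fun r => Nat.casesOn r v R.pick
  F := R.F
  d := R.d
  start := rfl
  step := by
    rintro (_ | r) hr
    · simpa [R.start] using h
    · exact R.step r (by omega)
  last := R.last
  pick_none := by
    rintro (_ | r) hr
    · exact hv
    · exact R.pick_none r (by omega)
  pick_colored := by
    rintro (_ | r) hr
    · simpa [R.start] using hv'
    · exact R.pick_colored r (by omega)
  pick_min := by
    rintro (_ | r) hr
    · exact hmin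
    · exact R.pick_min r (by omega)
  card_step := by
    rintro (_ | r) hr
    · simpa [R.start] using hc
    · exact R.card_step r (by omega)
  card_last := R.card_last
  dead_none := R.dead_none
  dead := R.dead

theorem exists_losingRun (G : SimpleGraph V) (m : ℕ) : ∀ c : Position V k,
    (Finset.univ.filter fun v => c v = none).card ≤ m → ¬ MakerWins G .maker c →
    Nonempty (LosingRun G c) := by
  induction m with
  | zero =>
    intro c hm hc
    refine absurd (MakerWins.finished _ c fun v hv => ?_) hc
    have : v ∈ (Finset.univ.filter fun v => c v = none) := by simp [hv]
    rw [Finset.card_eq_zero.1 (Nat.le_zero.1 hm)] at this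
    simp at this
  | succ m ih =>
    intro c hm hc
    have hne : (Finset.univ.filter fun v => c v = none).Nonempty := by
      by_contra hemp
      refine hc (MakerWins.finished _ c fun v hv => hemp ⟨v, by simp [hv]⟩)
    obtain ⟨v, hv, hmin⟩ := Finset.exists_min_image _ (fun v => (avail G c v).card) hne
    simp only [Finset.mem_filter, Finset.mem_univ, true_and] at hv hmin
    rcases (avail G c v).eq_empty_or_nonempty with hemp | ⟨i, hi⟩
    · exact ⟨LosingRun.nil c v (fun _ _ h => h) (by omega) hv hemp⟩
    have hleg : Legal G c v i := by
      simp only [avail, Finset.mem_filter, Finset.mem_univ, true_and] at hi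
      exact ⟨hv, hi⟩
    have hb : ¬ MakerWins G .breaker (play c v i) := fun h => hc (.maker c v i hleg h)
    have hext := extends_play hv i
    have hcard := card_uncolored_play hv i
    by_cases hst : Stuck G (play c v i)
    · obtain ⟨d, hd, hall⟩ := hst
      refine ⟨LosingRun.nil (play c v i) d hext (by omega) hd ?_⟩
      rw [Finset.eq_empty_iff_forall_notMem]
      intro j hj
      simp only [avail, Finset.mem_filter, Finset.mem_univ, true_and] at hj
      obtain ⟨w, hw, hw'⟩ := hall j
      exact hj w hw hw'
    · have : ∃ w j, Legal G (play c v i) w j ∧ ¬ MakerWins G .maker (play (play c v i) w j) := by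
        by_contra! hcon
        exact hb (.breaker _ hst hcon)
      obtain ⟨w, j, hl, hw⟩ := this
      have hcard' := card_uncolored_play hl.1 j
      obtain ⟨R⟩ := ih _ (by omega) hw
      refine ⟨R.cons v (hext.trans (extends_play hl.1 j)) hv ?_ hmin (by omega)⟩
      rw [extends_play hl.1 j v i (play_self c v i)]
      simp

namespace LosingRun

variable {G : SimpleGraph V} {c₀ : Position V k} (R : LosingRun G c₀)

omit [DecidableEq V] in
theorem extends_of_le {r s : ℕ} (hrs : r ≤ s) (hs : s ≤ R.N) : Extends (R.c r) (R.c s) := by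
  induction s, hrs using Nat.le_induction with
  | base => exact fun _ _ h => h
  | succ s _ ih => exact (ih (by omega)).trans (R.step s (by omega))

omit [DecidableEq V] in
theorem extends_last {r : ℕ} (hr : r ≤ R.N) : Extends (R.c r) R.F :=
  (R.extends_of_le hr le_rfl).trans R.last

/-- The vertices colored from round `r` on, and the dead vertex. -/
def active (r : ℕ) : Finset V :=
  Finset.univ.filter fun v => R.c r v = none ∧ (R.F v ≠ none ∨ v = R.d)

omit [DecidableEq V] in
theorem card_uncolored_le {r : ℕ} (hr : r ≤ R.N) :
    (Finset.univ.filter fun v => R.c r v = none).card ≤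
      (Finset.univ.filter fun v => R.F v = none).card + 1 + 2 * (R.N - r) := by
  induction hr using Nat.decreasingInduction with
  | self => have := R.card_last; omega
  | of_succ r hr ih => have := R.card_step r hr; omega

theorem card_active_le {r : ℕ} (hr : r ≤ R.N) : (R.active r).card ≤ 2 * (R.N - r) + 2 := by
  have h1 := R.card_uncolored_le hr
  have h2 : (R.active r).card + ((Finset.univ.filter fun v => R.F v = none).erase R.d).card ≤
      (Finset.univ.filter fun v => R.c r v = none).card := by
    rw [← Finset.card_union_of_disjoint]
    · refine Finset.card_le_card fun v hv => ?_
      simp only [active, Finset.mem_union, Finset.mem_filter, Finset.mem_univ, true_and,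
        Finset.mem_erase] at hv ⊢
      rcases hv with hv | hv
      · exact hv.1
      · exact (R.extends_last hr).eq_none hv.2
    · rw [Finset.disjoint_left]
      intro v hv hv'
      simp only [active, Finset.mem_filter, Finset.mem_univ, true_and,
        Finset.mem_erase] at hv hv'
      tauto
  have h3 := Finset.card_erase_add_one
    (show R.d ∈ (Finset.univ.filter fun v => R.F v = none) by simp [R.dead_none])
  omega

theorem card_avail_le_active {r : ℕ} (hr : r ≤ R.N) [DecidableRel G.Adj] (v : V) :
    (avail G (R.c r) v).card ≤ (avail G R.F v).card +
      ((R.active r).filter fun w => G.Adj v w).card := by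
  convert card_avail_le G (R.c r) R.F v (R.active r) ?_ (R.extends_last hr)
  intro w h1 h2
  simp [active, h1, h2]

/-- After the last time at which all uncolored vertices have at least `θ` available colors, Maker
only picks vertices that end up with fewer than `θ` available colors, so few rounds remain if there
are few such vertices. -/
theorem exists_late {r θ : ℕ} (hr : r ≤ R.N)
    (hθ : ∀ v, R.c r v = none → θ ≤ (avail G (R.c r) v).card) :
    ∃ r', r' ≤ R.N ∧ (∀ v, R.c r' v = none → θ ≤ (avail G (R.c r') v).card) ∧
      (R.active r').card ≤
        2 * (((R.active r).filter fun v => (avail G R.F v).card < θ).card + 1) + 2 := by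
  classical
  let P : ℕ → Prop := fun s => r ≤ s ∧ ∀ v, R.c s v = none → θ ≤ (avail G (R.c s) v).card
  have hP : P (Nat.findGreatest P R.N) := Nat.findGreatest_spec hr ⟨le_rfl, hθ⟩
  set r' := Nat.findGreatest P R.N with hr'
  have hr'N : r' ≤ R.N := Nat.findGreatest_le _
  refine ⟨r', hr'N, hP.2, (R.card_active_le hr'N).trans ?_⟩
  have hlate : ∀ s ∈ Finset.Ioo r' R.N, (avail G (R.c s) (R.pick s)).card < θ := by
    intro s hs
    rw [Finset.mem_Ioo] at hs
    have hnot := Nat.findGreatest_is_greatest hs.1 hs.2.le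
    have : ∃ v, R.c s v = none ∧ (avail G (R.c s) v).card < θ := by
      by_contra! hcon
      exact hnot ⟨hP.1.trans hs.1.le, hcon⟩
    obtain ⟨v, hv, hv'⟩ := this
    exact (R.pick_min s hs.2 v hv).trans_lt hv'
  have hcard : (Finset.Ioo r' R.N).card ≤
      ((R.active r).filter fun v => (avail G R.F v).card < θ).card := by
    refine Finset.card_le_card_of_injOn R.pick ?_ ?_
    · intro s hs
      have hs' := Finset.mem_Ioo.1 (Finset.mem_coe.1 hs)
      simp only [active, Finset.coe_filter, Set.mem_ofPred_eq, Finset.mem_filter, Finset.mem_univ,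
        true_and]
      refine ⟨⟨(R.extends_of_le (hP.1.trans hs'.1.le) hs'.2.le).eq_none (R.pick_none s hs'.2),
        Or.inl fun h => R.pick_colored s hs'.2 ((R.extends_last hs'.2).eq_none h)⟩, ?_⟩
      exact (Finset.card_le_card (avail_anti G (R.extends_last hs'.2.le) _)).trans_lt
        (hlate s (Finset.mem_coe.1 hs))
    · have aux : ∀ s s', s < s' → s' < R.N → R.pick s ≠ R.pick s' := by
        intro s s' hss hs' heq
        refine R.pick_colored s (hss.trans hs') ?_
        rw [heq]
        exact (R.extends_of_le hss hs'.le).eq_none (R.pick_none s' hs')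
      intro s hs s' hs' heq
      have h1 := Finset.mem_Ioo.1 (Finset.mem_coe.1 hs)
      have h2 := Finset.mem_Ioo.1 (Finset.mem_coe.1 hs')
      rcases lt_trichotomy s s' with h | h | h
      · exact absurd heq (aux s s' h h2.2)
      · exact h
      · exact absurd heq.symm (aux s' s h h1.2)
  rw [Nat.card_Ioo] at hcard
  omega

/-- If small vertex sets span few edges, then no run can be lost by Maker from a position in which
few vertices remain active and every uncolored vertex has enough available colors: passing to a
later round costs `g (j + 1)` available colors and halves the number of active vertices. -/
theorem false_of_sparse [DecidableRel G.Adj] (g : ℕ → ℕ)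
    (hg : ∀ j (S : Finset V), S.card ≤ 16 * 2 ^ j →
      8 * (S.filter fun v => g j ≤ (S.filter fun w => G.Adj v w).card).card ≤ S.card)
    (j : ℕ) : ∀ r ≤ R.N, (R.active r).card ≤ 16 * 2 ^ j →
      (∀ v, R.c r v = none →
        17 + ∑ i ∈ Finset.range (j + 1), g i ≤ (avail G (R.c r) v).card) → False := by
  -- at most 16 active vertices cannot use up 17 available colors
  have small : ∀ r ≤ R.N, (R.active r).card ≤ 16 →
      (∀ v, R.c r v = none → 17 ≤ (avail G (R.c r) v).card) → False := by
    intro r hr hS h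
    have h1 := h R.d ((R.extends_last hr).eq_none R.dead_none)
    have h2 := R.card_avail_le_active hr R.d
    have h3 := Finset.card_filter_le (R.active r) fun w => G.Adj R.d w
    rw [R.dead, Finset.card_empty] at h2
    omega
  induction j with
  | zero =>
    intro r hr hS h
    exact small r hr (by simpa using hS) fun v hv => le_trans (by omega) (h v hv)
  | succ j ih =>
    intro r hr hS h
    by_cases h16 : (R.active r).card ≤ 16
    · exact small r hr h16 fun v hv => le_trans (by omega) (h v hv)
    rw [Finset.sum_range_succ] at h
    obtain ⟨r', hr', hav, hcard⟩ := R.exists_late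
      (θ := 17 + ∑ i ∈ Finset.range (j + 1), g i) hr fun v hv => le_trans (by omega) (h v hv)
    refine ih r' hr' (hcard.trans ?_) hav
    have hsub : ((R.active r).filter fun v => (avail G R.F v).card <
        17 + ∑ i ∈ Finset.range (j + 1), g i) ⊆
        (R.active r).filter fun v => g (j + 1) ≤
          ((R.active r).filter fun w => G.Adj v w).card := by
      intro v hv
      rw [Finset.mem_filter] at hv ⊢
      refine ⟨hv.1, ?_⟩
      have h1 := h v (by simpa [active] using (Finset.mem_filter.1 hv.1).2.1)
      have h2 := R.card_avail_le_active hr v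
      omega
    have h1 := Finset.card_le_card hsub
    have h2 := hg (j + 1) _ hS
    rw [pow_succ] at hS
    omega

end LosingRun

/-- Sufficient conditions for Maker to win: in every partial coloring all but `m` vertices have at
least `A` available colors, and small vertex sets contain few vertices of large inner degree. The
summand `17` takes care of the last at most `16` active vertices. -/
theorem makerWins_of_sparse (G : SimpleGraph V) [DecidableRel G.Adj] (A m j : ℕ) (g : ℕ → ℕ)
    (hA : ∀ c : Position V k,
      (Finset.univ.filter fun v => (avail G c v).card < A).card ≤ m)
    (hg : ∀ j (S : Finset V), S.card ≤ 16 * 2 ^ j →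
      8 * (S.filter fun v => g j ≤ (S.filter fun w => G.Adj v w).card).card ≤ S.card)
    (hAk : A ≤ k) (hgA : 17 + ∑ i ∈ Finset.range (j + 1), g i ≤ A)
    (hm : 2 * m + 4 ≤ 16 * 2 ^ j) :
    MakerWins G .maker (fun _ => none : Position V k) := by
  by_contra hcon
  obtain ⟨R⟩ := exists_losingRun G _ _ le_rfl hcon
  obtain ⟨r, hr, hav, hcard⟩ := R.exists_late (r := 0) (θ := A) (Nat.zero_le _) (by
    intro v _
    rw [R.start]
    simpa [avail] using hAk)
  refine R.false_of_sparse g hg j r hr (hcard.trans ?_) fun v hv => hgA.trans (hav v hv)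
  have h1 := hA R.F
  have h2 := Finset.card_le_card (Finset.filter_subset_filter
    (fun v => (avail G R.F v).card < A) (Finset.subset_univ (R.active 0)))
  omega

end ColoringGame

/-! ### Breaker's strategy on a pseudorandom bipartite graph -/

namespace RandomBipartite

open ColoringGame Finset

variable {n k : ℕ}

/-- The vertices of the first part without neighbors in the subset `S` of the second part. -/
def freeL (E : Finset (Fin n × Fin n)) (S : Finset (Fin n)) : Finset (Fin n) :=
  univ.filter fun x => ∀ y ∈ S, (x, y) ∉ E

/-- The vertices of the second part without neighbors in the subset `T` of the first part. -/
def freeR (E : Finset (Fin n × Fin n)) (T : Finset (Fin n)) : Finset (Fin n) :=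
  univ.filter fun y => ∀ x ∈ T, (x, y) ∉ E

/-- The vertices of color `i` in the first part. -/
def colorL (c : Position (Fin n ⊕ Fin n) k) (i : Fin k) : Finset (Fin n) :=
  univ.filter fun x => c (.inl x) = some i

/-- The vertices of color `i` in the second part. -/
def colorR (c : Position (Fin n ⊕ Fin n) k) (i : Fin k) : Finset (Fin n) :=
  univ.filter fun y => c (.inr y) = some i

/-- The colored vertices of the first part. -/
def usedL (c : Position (Fin n ⊕ Fin n) k) : Finset (Fin n) :=
  univ.filter fun x => c (.inl x) ≠ none

/-- The colored vertices of the second part. -/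
def usedR (c : Position (Fin n ⊕ Fin n) k) : Finset (Fin n) :=
  univ.filter fun y => c (.inr y) ≠ none

theorem freeR_anti (E : Finset (Fin n × Fin n)) {T T' : Finset (Fin n)} (h : T ⊆ T') :
    freeR E T' ⊆ freeR E T :=
  fun y hy => by
    simp only [freeR, mem_filter, mem_univ, true_and] at hy ⊢
    exact fun x hx => hy x (h hx)

section Extension

variable {c c' : Position (Fin n ⊕ Fin n) k}

theorem colorL_mono (h : Extends c c') (i : Fin k) : colorL c i ⊆ colorL c' i := fun x hx => by
  simp only [colorL, mem_filter, mem_univ, true_and] at hx ⊢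
  exact h _ _ hx

theorem colorR_mono (h : Extends c c') (i : Fin k) : colorR c i ⊆ colorR c' i := fun x hx => by
  simp only [colorR, mem_filter, mem_univ, true_and] at hx ⊢
  exact h _ _ hx

theorem usedL_mono (h : Extends c c') : usedL c ⊆ usedL c' := fun x hx => by
  simp only [usedL, mem_filter, mem_univ, true_and] at hx ⊢
  exact fun h' => hx (h.eq_none h')

theorem colorL_play_inl (c : Position (Fin n ⊕ Fin n) k) (x : Fin n) (i : Fin k) :
    colorL (play c (.inl x) i) i = insert x (colorL c i) := by
  ext z
  by_cases h : z = x <;> simp [colorL, play, h]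

theorem colorL_play_inl_of_ne {x : Fin n} (hx : c (.inl x) = none) {i i' : Fin k}
    (h : i' ≠ i) : colorL (play c (.inl x) i) i' = colorL c i' := by
  ext z
  by_cases hz : z = x <;> simp [colorL, play, hz, hx, h.symm]

theorem colorR_play_inl (c : Position (Fin n ⊕ Fin n) k) (x : Fin n) (i i' : Fin k) :
    colorR (play c (.inl x) i) i' = colorR c i' := by
  ext z
  simp [colorR, play]

theorem colorR_play_inr_of_ne {y : Fin n} (hy : c (.inr y) = none) {i i' : Fin k}
    (h : i' ≠ i) : colorR (play c (.inr y) i) i' = colorR c i' := by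
  ext z
  by_cases hz : z = y <;> simp [colorR, play, hz, hy, h.symm]

theorem colorR_play_inr (c : Position (Fin n ⊕ Fin n) k) (y : Fin n) (i : Fin k) :
    colorR (play c (.inr y) i) i = insert y (colorR c i) := by
  ext z
  by_cases h : z = y <;> simp [colorR, play, h]

theorem card_used_play (c : Position (Fin n ⊕ Fin n) k) (v : Fin n ⊕ Fin n) (i : Fin k) :
    (usedL (play c v i)).card + (usedR (play c v i)).card ≤
      (usedL c).card + (usedR c).card + 1 := by
  rcases v with x | y
  · have h1 : usedL (play c (.inl x) i) ⊆ insert x (usedL c) := by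
      intro z hz
      by_cases h : z = x <;> simp_all [usedL, play]
    have h2 : usedR (play c (.inl x) i) = usedR c := by
      ext z
      simp [usedR, play]
    have := (card_le_card h1).trans (card_insert_le _ _)
    rw [h2]
    omega
  · have h1 : usedR (play c (.inr y) i) ⊆ insert y (usedR c) := by
      intro z hz
      by_cases h : z = y <;> simp_all [usedR, play]
    have h2 : usedL (play c (.inr y) i) = usedL c := by
      ext z
      simp [usedL, play]
    have := (card_le_card h1).trans (card_insert_le _ _)
    rw [h2]
    omega

end Extension

theorem sum_comp_update_succ {M : Type*} [AddCommMonoid M] (f : ℕ → M) (l : Fin k → ℕ) (i : Fin k)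
    {a : M} (ha : f (l i + 1) = f (l i) + a) :
    ∑ j, f (Function.update l i (l i + 1) j) = ∑ j, f (l j) + a := by
  rw [← Finset.add_sum_erase univ _ (mem_univ i),
    ← Finset.add_sum_erase univ (fun j => f (l j)) (mem_univ i), Function.update_self, ha,
    add_right_comm]
  congr 2
  exact Finset.sum_congr rfl fun j hj => by
    rw [Function.update_of_ne (Finset.mem_erase.1 hj).1]

/-- If no subset of `B` receives many fewer edges from `A` than expected at density `p`, then for
all weights in `[0, 1]` some vertex of `A` sees almost a proportion `p` of the weight of `B`. -/
theorem exists_large_weighted_degree (E : Finset (Fin n × Fin n)) {A B : Finset (Fin n)}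
    (hA : A.Nonempty) {p d : ℝ} (w : Fin n → ℝ) (hw0 : ∀ y, 0 ≤ w y) (hw1 : ∀ y, w y ≤ 1)
    (hd : ∀ B' ⊆ B, p * (A.card * B'.card) - d * A.card ≤
      (((A ×ˢ B').filter fun e => e ∈ E).card : ℝ)) :
    ∃ x ∈ A, p * ∑ y ∈ B, w y - d ≤ ∑ y ∈ B.filter (fun y => (x, y) ∈ E), w y := by
  by_contra! hcon
  have h1 := Finset.sum_lt_sum_of_nonempty hA hcon
  have h2 : ∑ x ∈ A, ∑ y ∈ B.filter (fun y => (x, y) ∈ E), w y =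
      ∑ y ∈ B, w y * ((A.filter fun x => (x, y) ∈ E).card : ℝ) := by
    simp_rw [Finset.sum_filter]
    rw [Finset.sum_comm]
    refine Finset.sum_congr rfl fun y _ => ?_
    rw [← Finset.sum_filter, Finset.sum_const, nsmul_eq_mul, mul_comm]
  -- the vertices of `B` whose degree into `A` is smaller than expected
  set B' := B.filter fun y => ((A.filter fun x => (x, y) ∈ E).card : ℝ) < p * A.card with hB'
  have h3 := hd B' (Finset.filter_subset _ _)
  have h4 : (((A ×ˢ B').filter fun e => e ∈ E).card : ℝ) =
      ∑ y ∈ B', ((A.filter fun x => (x, y) ∈ E).card : ℝ) := by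
    rw [Finset.card_filter, Finset.sum_product_right]
    push_cast
    refine Finset.sum_congr rfl fun y _ => ?_
    rw [Finset.card_filter]
    push_cast
    rfl
  have h5 : ∑ y ∈ B', (((A.filter fun x => (x, y) ∈ E).card : ℝ) - p * A.card) ≤
      ∑ y ∈ B, w y * (((A.filter fun x => (x, y) ∈ E).card : ℝ) - p * A.card) := by
    rw [hB', Finset.sum_filter]
    refine Finset.sum_le_sum fun y _ => ?_
    split_ifs with h
    · nlinarith [hw1 y]
    · exact mul_nonneg (hw0 y) (by linarith)
  rw [h2] at h1
  rw [Finset.sum_sub_distrib, ← h4, Finset.sum_const, nsmul_eq_mul] at h5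
  simp_rw [mul_sub] at h5
  rw [Finset.sum_sub_distrib, ← Finset.sum_mul] at h5
  rw [Finset.sum_const, nsmul_eq_mul] at h1
  nlinarith

/-- The factor of the color `i` and the vertex `y` in Breaker's potential: if `i` is not bad and no
vertex of color `i` in the first part is adjacent to `y`, then it is the probability that at least
one of `t - l i` further vertices, each adjacent to `y` with probability `1 - q`, is. -/
noncomputable def factor (E : Finset (Fin n × Fin n)) (q : ℝ) (t : ℕ)
    (c : Position (Fin n ⊕ Fin n) k) (l : Fin k → ℕ) (J : Finset (Fin k)) (y : Fin n)
    (i : Fin k) : ℝ :=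
  if i ∉ J ∧ y ∈ freeR E (colorL c i) then 1 - q ^ (t - l i) else 1

/-- Breaker's potential: an estimate for the number of vertices of the second part for which all
colors outside `J` will become unavailable, if Breaker still plays each such color `i` on
`t - l i` random vertices of the first part. -/
noncomputable def potential (E : Finset (Fin n × Fin n)) (q : ℝ) (t : ℕ)
    (c : Position (Fin n ⊕ Fin n) k) (l : Fin k → ℕ) (J : Finset (Fin k)) : ℝ :=
  ∑ y, ∏ i, factor E q t c l J y i

section Potential

variable {E : Finset (Fin n × Fin n)} {q : ℝ} {t : ℕ} {c c' : Position (Fin n ⊕ Fin n) k}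
  {l : Fin k → ℕ} {J J' : Finset (Fin k)}

theorem factor_nonneg (hq0 : 0 ≤ q) (hq1 : q ≤ 1) (y : Fin n) (i : Fin k) :
    0 ≤ factor E q t c l J y i := by
  unfold factor
  split_ifs
  · linarith [pow_le_one₀ hq0 hq1 (n := t - l i)]
  · exact zero_le_one

theorem factor_le_one (hq0 : 0 ≤ q) (y : Fin n) (i : Fin k) :
    factor E q t c l J y i ≤ 1 := by
  unfold factor
  split_ifs
  · linarith [pow_nonneg hq0 (t - l i)]
  · exact le_rfl

theorem potential_mono (hq0 : 0 ≤ q) (hq1 : q ≤ 1) (h : Extends c c') (hJ : J ⊆ J') :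
    potential E q t c l J ≤ potential E q t c' l J' := by
  refine Finset.sum_le_sum fun y _ => Finset.prod_le_prod
    (fun i _ => factor_nonneg hq0 hq1 y i) fun i _ => ?_
  by_cases h' : i ∉ J' ∧ y ∈ freeR E (colorL c' i)
  · have : i ∉ J ∧ y ∈ freeR E (colorL c i) :=
      ⟨fun hi => h'.1 (hJ hi), freeR_anti E (colorL_mono h i) h'.2⟩
    simp [factor, h', this]
  · rw [factor.eq_1 E q t c' l J' y i, if_neg h']
    exact factor_le_one hq0 y i

/-- Some vertex `x` of `A` can be given the color `i` at the expense of a small loss of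
potential. -/
theorem exists_potential_le (hq0 : 0 ≤ q) (hq1 : q ≤ 1) {i : Fin k} (hi : i ∉ J) (hl : l i < t)
    {A : Finset (Fin n)} (hA : A.Nonempty) (hAc : ∀ x ∈ A, c (.inl x) = none) {d : ℝ}
    (hd : ∀ B' ⊆ freeR E (colorL c i), (1 - q) * (A.card * B'.card) - d * A.card ≤
      (((A ×ˢ B').filter fun e => e ∈ E).card : ℝ)) :
    ∃ x ∈ A, potential E q t c l J - q ^ (t - 1 - l i) * d ≤
      potential E q t (play c (.inl x) i) (Function.update l i (l i + 1)) J := by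
  set B := freeR E (colorL c i) with hB
  let w : Fin n → ℝ := fun y => ∏ j ∈ univ.erase i, factor E q t c l J y j
  have hw0 : ∀ y, 0 ≤ w y := fun y => Finset.prod_nonneg fun j _ => factor_nonneg hq0 hq1 y j
  have hw1 : ∀ y, w y ≤ 1 := fun y => Finset.prod_le_one
    (fun j _ => factor_nonneg hq0 hq1 y j) fun j _ => factor_le_one hq0 y j
  obtain ⟨x, hx, hdeg⟩ := exists_large_weighted_degree E hA w hw0 hw1 hd
  refine ⟨x, hx, ?_⟩
  have hxc := hAc x hx
  have hold : ∀ y, ∏ j, factor E q t c l J y j =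
      (if y ∈ B then 1 - q * q ^ (t - 1 - l i) else 1) * w y := by
    intro y
    rw [← Finset.mul_prod_erase univ _ (mem_univ i), ← pow_succ',
      show t - 1 - l i + 1 = t - l i by omega]
    simp [factor, hi, hB, w]
  have hnew : ∀ y, ∏ j, factor E q t (play c (.inl x) i) (Function.update l i (l i + 1)) J y j =
      (if y ∈ B ∧ (x, y) ∉ E then 1 - q ^ (t - 1 - l i) else 1) * w y := by
    intro y
    rw [← Finset.mul_prod_erase univ _ (mem_univ i)]
    congr 1
    · simp only [factor, hi, colorL_play_inl, hB, freeR, mem_filter, mem_univ, true_and,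
        mem_insert, forall_eq_or_imp, not_false_eq_true, Function.update_self,
        show t - (l i + 1) = t - 1 - l i by omega]
      simp only [and_comm]
    · refine Finset.prod_congr rfl fun j hj => ?_
      have hji := (Finset.mem_erase.1 hj).1
      simp [factor, colorL_play_inl_of_ne hxc hji, hji]
  have hdiff : potential E q t (play c (.inl x) i) (Function.update l i (l i + 1)) J -
      potential E q t c l J =
      q ^ (t - 1 - l i) * (∑ y ∈ B.filter (fun y => (x, y) ∈ E), w y - (1 - q) * ∑ y ∈ B, w y) := by
    unfold potential
    rw [← Finset.sum_sub_distrib, Finset.sum_filter, Finset.mul_sum, ← Finset.sum_sub_distrib,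
      Finset.mul_sum, ← Finset.sum_filter_add_sum_filter_not univ (· ∈ B)]
    have hz : ∑ y ∈ univ.filter (· ∉ B), (∏ j, factor E q t (play c (.inl x) i)
        (Function.update l i (l i + 1)) J y j - ∏ j, factor E q t c l J y j) = 0 := by
      refine Finset.sum_eq_zero fun y hy => ?_
      have hy' := (mem_filter.1 hy).2
      rw [hold, hnew]
      simp [hy']
    rw [hz, add_zero, show univ.filter (· ∈ B) = B by ext; simp]
    refine Finset.sum_congr rfl fun y hy => ?_
    rw [hold, hnew]
    by_cases hxy : (x, y) ∈ E
    · simp only [hy, hxy, not_true, and_false, if_true, if_false]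
      ring
    · simp only [hy, hxy, not_false_eq_true, and_true, if_true, if_false]
      ring
  have := pow_nonneg hq0 (t - 1 - l i)
  nlinarith

end Potential

/-- The pseudorandomness of a bipartite graph of density `1 - q` that lets Breaker win the game
with `k` colors by playing each color on `t` vertices of the first part. Sets of at most `t` vertices
have about as many common non-neighbors as expected (`upper`, `lower`). A set of at most `x` vertices
cannot contain a constant proportion of the common non-neighbors of many disjoint sets (`block`), so
that few colors turn bad. The edges are evenly distributed (`disc`), so that the vertex for a color
that Breaker has played `r` times can be chosen among the legal ones at a loss of potential of at
most `q ^ (t - 1 - r) * d r`. -/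
structure Pseudorandom (E : Finset (Fin n × Fin n)) (q : ℝ) (k t x : ℕ) (δ : ℝ) (d : ℕ → ℝ) :
    Prop where
  upper : ∀ T : Finset (Fin n), T.card ≤ t → ((freeR E T).card : ℝ) ≤ 2 * (n * q ^ T.card)
  lower : ∀ S : Finset (Fin n), S.card ≤ t → (n * q ^ S.card) / 2 ≤ ((freeL E S).card : ℝ)
  block : ∀ (X : Finset (Fin n)) (J : Finset (Fin k)) (S : Fin k → Finset (Fin n)),
    X.card ≤ x → (∀ i, (S i).card ≤ t) → (∀ i j, i ≠ j → Disjoint (S i) (S j)) →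
    (∀ i ∈ J, (n * q ^ (S i).card) / 4 ≤ ((freeL E (S i) ∩ X).card : ℝ)) →
    ∑ i ∈ J, q ^ (S i).card ≤ δ
  disc : ∀ r < t, ∀ A B : Finset (Fin n), A.card = ⌈n * q ^ (r + 1) / 4⌉₊ →
    (B.card : ℝ) ≤ 2 * (n * q ^ r) →
    (1 - q) * (A.card * B.card) - d r * A.card ≤ (((A ×ˢ B).filter fun e => e ∈ E).card : ℝ)

/-- The invariant maintained by Breaker. Here `l i` counts the vertices of the first part on which
Breaker has played the color `i`, and the bad colors `i ∈ J` are those which had only few legal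
vertices left in the first part while `l i < t`. The parameter `e` is `0` when it is Maker's turn
and `1` when it is Breaker's turn. -/
structure BreakerInv (E : Finset (Fin n × Fin n)) (q : ℝ) (t : ℕ) (d : ℕ → ℝ) (e : ℕ)
    (c : Position (Fin n ⊕ Fin n) k) (l : Fin k → ℕ) (J : Finset (Fin k)) : Prop where
  le : ∀ i, l i ≤ t
  le_card : ∀ i, l i ≤ (colorL c i).card
  balanced : ∀ i, i ∉ J → l i < t → (colorR c i).card ≤ l i + e
  bad : ∀ i ∈ J, ∃ S ⊆ colorR c i, S.card ≤ l i + 1 ∧ S.card ≤ t ∧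
    ((freeL E S \ usedL c).card : ℝ) < (n * q ^ S.card) / 4
  used : (usedL c).card + (usedR c).card ≤ 2 * ∑ i, l i + e
  potential : n * (1 - q ^ t) ^ k - ∑ i, ∑ r ∈ range (l i), q ^ (t - 1 - r) * d r ≤
    potential E q t c l J

section Strategy

variable {E : Finset (Fin n × Fin n)} {q : ℝ} {t x : ℕ} {δ : ℝ} {d : ℕ → ℝ}
  {c : Position (Fin n ⊕ Fin n) k} {l : Fin k → ℕ} {J : Finset (Fin k)}

/-- After a move of Maker the open colors with few legal vertices in the first part are declared
bad. At most one open color, which is the one just played, needs an answer. -/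
theorem BreakerInv.maker_move (hq0 : 0 ≤ q) (hq1 : q ≤ 1) (h : BreakerInv E q t d 0 c l J)
    {v : Fin n ⊕ Fin n} {i : Fin k} (hv : c v = none) :
    ∃ J', BreakerInv E q t d 1 (play c v i) l J' ∧
      (∀ j, j ∉ J' → l j < t → j ≠ i → (colorR (play c v i) j).card ≤ l j) ∧
      ∀ j, j ∉ J' → l j < t → (n * q ^ (colorR (play c v i) j).card) / 4 ≤
        ((freeL E (colorR (play c v i) j) \ usedL (play c v i)).card : ℝ) := by
  classical
  have hext := extends_play hv i
  have hne : ∀ j, j ≠ i → colorR (play c v i) j = colorR c j := by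
    intro j hj
    rcases v with x | y
    · exact colorR_play_inl c x i j
    · exact colorR_play_inr_of_ne hv hj
  have hcard : ∀ j, (colorR (play c v i) j).card ≤ (colorR c j).card + 1 := by
    intro j
    by_cases hj : j = i
    · subst hj
      rcases v with x | y
      · rw [colorR_play_inl]; omega
      · rw [colorR_play_inr]; exact card_insert_le _ _
    · rw [hne j hj]; omega
  set J' := J ∪ univ.filter fun j => l j < t ∧ j ∉ J ∧
    ((freeL E (colorR (play c v i) j) \ usedL (play c v i)).card : ℝ) <
      (n * q ^ (colorR (play c v i) j).card) / 4 with hJ'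
  have hnot : ∀ j, j ∉ J' → j ∉ J := fun j hj hj' => hj (mem_union_left _ hj')
  refine ⟨J', ⟨h.le, fun j => (h.le_card j).trans (card_le_card (colorL_mono hext j)), ?_, ?_, ?_,
    h.potential.trans (potential_mono hq0 hq1 hext subset_union_left)⟩, ?_, ?_⟩
  · intro j hj hlt
    have := h.balanced j (hnot j hj) hlt
    have := hcard j
    omega
  · intro j hj
    rw [hJ', mem_union, mem_filter] at hj
    rcases hj with hj | ⟨-, hlt, hj, hfew⟩
    · obtain ⟨S, hS, h1, h2, h3⟩ := h.bad j hj
      refine ⟨S, hS.trans (colorR_mono hext j), h1, h2, lt_of_le_of_lt ?_ h3⟩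
      exact_mod_cast card_le_card (sdiff_subset_sdiff le_rfl (usedL_mono hext))
    · have := h.balanced j hj hlt
      have := hcard j
      exact ⟨_, Subset.rfl, by omega, by omega, hfew⟩
  · have := card_used_play c v i
    have := h.used
    omega
  · intro j hj hlt hji
    rw [hne j hji]
    exact h.balanced j (hnot j hj) hlt
  · intro j hj hlt
    by_contra! hcon
    exact hj (mem_union_right _ (mem_filter.2 ⟨mem_univ j, hlt, hnot j hj, hcon⟩))

/-- Breaker plays the open color `i` on a suitable vertex of the first part. -/
theorem BreakerInv.breaker_move (hE : Pseudorandom E q k t x δ d) (hn : 0 < n) (hq0 : 0 < q)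
    (hq1 : q ≤ 1) (h : BreakerInv E q t d 1 c l J) {i : Fin k} (hi : i ∉ J) (hl : l i < t)
    (hothers : ∀ j, j ∉ J → l j < t → j ≠ i → (colorR c j).card ≤ l j)
    (hmany : (n * q ^ (colorR c i).card) / 4 ≤ ((freeL E (colorR c i) \ usedL c).card : ℝ)) :
    ∃ x, Legal (bipartiteGraph (E : Set (Fin n × Fin n))) c (.inl x) i ∧
      BreakerInv E q t d 0 (play c (.inl x) i) (Function.update l i (l i + 1)) J := by
  have hnR : (0 : ℝ) < n := by exact_mod_cast hn
  have hcard : ⌈(n : ℝ) * q ^ (l i + 1) / 4⌉₊ ≤ (freeL E (colorR c i) \ usedL c).card := by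
    refine Nat.ceil_le.2 (le_trans ?_ hmany)
    have := pow_le_pow_of_le_one hq0.le hq1 (h.balanced i hi hl)
    gcongr
  obtain ⟨A, hAsub, hAcard⟩ := Finset.exists_subset_card_eq hcard
  have hA : A.Nonempty := by
    rw [← Finset.card_pos, hAcard, Nat.ceil_pos]
    positivity
  have hAc : ∀ z ∈ A, c (.inl z) = none := by
    intro z hz
    have := (mem_sdiff.1 (hAsub hz)).2
    simpa [usedL] using this
  obtain ⟨T, hTsub, hTcard⟩ := Finset.exists_subset_card_eq (h.le_card i)
  have hup : ((freeR E (colorL c i)).card : ℝ) ≤ 2 * (n * q ^ l i) := by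
    have := hE.upper T (by omega)
    rw [hTcard] at this
    refine le_trans ?_ this
    exact_mod_cast card_le_card (freeR_anti E hTsub)
  obtain ⟨z, hz, hpot⟩ := exists_potential_le (E := E) (l := l) (t := t) hq0.le hq1 hi hl hA hAc
    (d := d (l i)) fun B' hB' => hE.disc (l i) hl A B' hAcard
      (le_trans (by exact_mod_cast card_le_card hB') hup)
  have hzc := hAc z hz
  have hext := extends_play hzc i
  refine ⟨z, ⟨hzc, ?_⟩, ?_⟩
  · rintro (w | w) hw hcw
    · exact hw
    · have h1 := (mem_sdiff.1 (hAsub hz)).1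
      simp only [freeL, mem_filter, mem_univ, true_and] at h1
      exact h1 w (by simpa [colorR] using hcw) (by simpa [bipartiteGraph] using hw)
  have hsum : ∑ j, Function.update l i (l i + 1) j = ∑ j, l j + 1 :=
    sum_comp_update_succ (fun r => r) l i rfl
  have hsum' : ∑ j, ∑ r ∈ range (Function.update l i (l i + 1) j), q ^ (t - 1 - r) * d r =
      ∑ j, ∑ r ∈ range (l j), q ^ (t - 1 - r) * d r + q ^ (t - 1 - l i) * d (l i) :=
    sum_comp_update_succ (fun m => ∑ r ∈ range m, q ^ (t - 1 - r) * d r) l i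
      (Finset.sum_range_succ _ _)
  refine ⟨?_, ?_, ?_, ?_, ?_, ?_⟩
  · intro j
    by_cases hj : j = i
    · subst hj; rw [Function.update_self]; omega
    · rw [Function.update_of_ne hj]; exact h.le j
  · intro j
    by_cases hj : j = i
    · subst hj
      rw [Function.update_self, colorL_play_inl, card_insert_of_notMem]
      · have := h.le_card j
        omega
      · simp [colorL, hzc]
    · rw [Function.update_of_ne hj, colorL_play_inl_of_ne hzc hj]; exact h.le_card j
  · intro j hjJ hlt
    rw [colorR_play_inl]
    by_cases hj : j = i
    · subst hj
      rw [Function.update_self]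
      exact h.balanced j hi hl
    · rw [Function.update_of_ne hj] at hlt ⊢
      exact hothers j hjJ hlt hj
  · intro j hj
    obtain ⟨S, hS, h1, h2, h3⟩ := h.bad j hj
    refine ⟨S, hS.trans (colorR_mono hext j), h1.trans ?_, h2, lt_of_le_of_lt ?_ h3⟩
    · by_cases hj : j = i
      · subst hj; rw [Function.update_self]; omega
      · rw [Function.update_of_ne hj]
    · exact_mod_cast card_le_card (sdiff_subset_sdiff le_rfl (usedL_mono hext))
  · have := card_used_play c (.inl z) i
    have := h.used
    rw [hsum]
    omega
  · have := h.potential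
    rw [hsum']
    linarith

theorem sum_le_mul (h : BreakerInv E q t d e c l J) : ∑ i, l i ≤ k * t := by
  have := Finset.sum_le_card_nsmul univ l t fun i _ => h.le i
  simpa using this

/-- When no open color is left, some vertex of the second part has no available color. -/
theorem BreakerInv.stuck (hE : Pseudorandom E q k t x δ d) (hq0 : 0 < q) (hq1 : q ≤ 1)
    (hx : 2 * (k * t) + 1 ≤ x) (hd : ∀ r, 0 ≤ d r)
    (hfin : 2 * (n * (δ / q)) + (2 * (k * t) + 1) + k * ∑ r ∈ range t, q ^ (t - 1 - r) * d r <
      n * (1 - q ^ t) ^ k)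
    (h : BreakerInv E q t d 1 c l J) (hclosed : ∀ j, j ∉ J → l j = t) :
    Stuck (bipartiteGraph (E : Set (Fin n × Fin n))) c := by
  classical
  have hsum := sum_le_mul h
  have hused := h.used
  -- the vertices at which all colors outside `J` are unavailable
  set D : Finset (Fin n) := univ.filter fun y => ∀ j, j ∉ J → y ∉ freeR E (colorL c j) with hD
  have hpot : RandomBipartite.potential E q t c l J = D.card := by
    rw [RandomBipartite.potential, hD, Finset.card_filter, Nat.cast_sum]
    refine Finset.sum_congr rfl fun y _ => ?_
    by_cases hy : ∀ j, j ∉ J → y ∉ freeR E (colorL c j)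
    · rw [if_pos hy, Nat.cast_one]
      refine Finset.prod_eq_one fun j _ => ?_
      rw [factor, if_neg]
      exact fun hj => hy j hj.1 hj.2
    · rw [if_neg hy, Nat.cast_zero]
      push Not at hy
      obtain ⟨j, hj, hj'⟩ := hy
      refine Finset.prod_eq_zero (mem_univ j) ?_
      rw [factor, if_pos ⟨hj, hj'⟩, hclosed j hj]
      simp
  have hloss : ∑ i, ∑ r ∈ range (l i), q ^ (t - 1 - r) * d r ≤
      k * ∑ r ∈ range t, q ^ (t - 1 - r) * d r := by
    have : ∀ i ∈ (univ : Finset (Fin k)), ∑ r ∈ range (l i), q ^ (t - 1 - r) * d r ≤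
        ∑ r ∈ range t, q ^ (t - 1 - r) * d r := fun i _ =>
      Finset.sum_le_sum_of_subset_of_nonneg (Finset.range_mono (h.le i))
        fun r _ _ => mul_nonneg (pow_nonneg hq0.le _) (hd r)
    have := Finset.sum_le_card_nsmul univ _ _ this
    simpa using this
  choose! S hS hS1 hS2 hS3 using h.bad
  have hblock : ∑ i ∈ J, q ^ (S i).card ≤ δ := by
    have := hE.block (usedL c) J (fun i => if i ∈ J then S i else ∅) (by omega) ?_ ?_ ?_
    · rwa [Finset.sum_congr rfl fun i hi => by rw [if_pos hi]] at this
    · intro i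
      by_cases hi : i ∈ J
      · simpa [hi] using hS2 i hi
      · simp [hi]
    · intro i j hij
      by_cases hi : i ∈ J
      · by_cases hj : j ∈ J
        · simp only [hi, hj, if_true]
          refine Finset.disjoint_of_subset_left (hS i hi) (Finset.disjoint_of_subset_right
            (hS j hj) ?_)
          rw [Finset.disjoint_left]
          intro y hy hy'
          simp only [colorR, mem_filter, mem_univ, true_and] at hy hy'
          rw [hy] at hy'
          exact hij (Option.some.inj hy')
        · simp [hj]
      · simp [hi]
    · intro i hi
      simp only [hi, if_true]
      have h1 := hE.lower (S i) (hS2 i hi)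
      have h2 := hS3 i hi
      have h3 : ((freeL E (S i) \ usedL c).card : ℝ) + ((freeL E (S i) ∩ usedL c).card : ℝ) =
          ((freeL E (S i)).card : ℝ) := by exact_mod_cast Finset.card_sdiff_add_card_inter _ _
      linarith
  have hJcov : ∀ i ∈ J, ((freeR E (colorL c i)).card : ℝ) ≤ 2 * (n / q) * q ^ (S i).card := by
    intro i hi
    obtain ⟨T, hTsub, hTcard⟩ := Finset.exists_subset_card_eq (h.le_card i)
    have h1 := hE.upper T (by have := h.le i; omega)
    rw [hTcard] at h1
    have h2 : ((freeR E (colorL c i)).card : ℝ) ≤ (freeR E T).card := by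
      exact_mod_cast card_le_card (freeR_anti E hTsub)
    have h3 : q ^ l i ≤ q ^ (S i).card / q := by
      rw [le_div_iff₀ hq0, ← pow_succ]
      exact pow_le_pow_of_le_one hq0.le hq1 (hS1 i hi)
    calc ((freeR E (colorL c i)).card : ℝ) ≤ 2 * (n * q ^ l i) := h2.trans h1
      _ ≤ 2 * (n * (q ^ (S i).card / q)) := by gcongr
      _ = 2 * (n / q) * q ^ (S i).card := by ring
  set U : Finset (Fin n) := usedR c ∪ J.biUnion fun i => freeR E (colorL c i) with hU
  have hUcard : (U.card : ℝ) ≤ (2 * (k * t) + 1) + 2 * (n * (δ / q)) := by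
    have h1 : (U.card : ℝ) ≤ (usedR c).card + ∑ i ∈ J, ((freeR E (colorL c i)).card : ℝ) := by
      exact_mod_cast (card_union_le _ _).trans (Nat.add_le_add_left card_biUnion_le _)
    have h2 : ((usedR c).card : ℝ) ≤ 2 * (k * t) + 1 := by
      exact_mod_cast (show (usedR c).card ≤ 2 * (k * t) + 1 by omega)
    have h3 := Finset.sum_le_sum hJcov
    rw [← Finset.mul_sum] at h3
    have h4 : 2 * ((n : ℝ) / q) * ∑ i ∈ J, q ^ (S i).card ≤ 2 * (n / q) * δ := by gcongr
    have h5 : 2 * ((n : ℝ) / q) * δ = 2 * (n * (δ / q)) := by ring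
    linarith
  have hlt : U.card < D.card := by
    have := h.potential
    rw [hpot] at this
    exact_mod_cast (show (U.card : ℝ) < D.card by linarith)
  obtain ⟨y, hyD, hyU⟩ := Finset.exists_mem_notMem_of_card_lt_card hlt
  simp only [hD, hU, mem_filter, mem_univ, true_and, mem_union, mem_biUnion, not_or, not_exists,
    not_and] at hyD hyU
  refine ⟨.inr y, by simpa [usedR] using hyU.1, fun i => ?_⟩
  have hfree : y ∉ freeR E (colorL c i) := by
    by_cases hi : i ∈ J
    · exact hyU.2 i hi
    · exact hyD i hi
  simp only [freeR, mem_filter, mem_univ, true_and, not_forall, not_not] at hfree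
  obtain ⟨z, hz, hzy⟩ := hfree
  exact ⟨.inl z, by simpa [bipartiteGraph] using hzy, by simpa [colorL] using hz⟩

/-- Maker does not win from a position satisfying Breaker's invariant. -/
theorem BreakerInv.not_makerWins (hE : Pseudorandom E q k t x δ d) (hq0 : 0 < q) (hq1 : q ≤ 1)
    (hx : 2 * (k * t) + 1 ≤ x) (hδ : 0 ≤ δ) (hd : ∀ r, 0 ≤ d r)
    (hfin : 2 * (n * (δ / q)) + (2 * (k * t) + 1) + k * ∑ r ∈ range t, q ^ (t - 1 - r) * d r <
      n * (1 - q ^ t) ^ k) (m : ℕ) :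
    ∀ (c : Position (Fin n ⊕ Fin n) k) (l : Fin k → ℕ) (J : Finset (Fin k)),
      k * t ≤ ∑ i, l i + m → BreakerInv E q t d 0 c l J →
      ¬ MakerWins (bipartiteGraph (E : Set (Fin n × Fin n))) .maker c := by
  have hqt : (1 - q ^ t) ^ k ≤ 1 := pow_le_one₀
    (by linarith [pow_le_one₀ hq0.le hq1 (n := t)]) (by linarith [pow_nonneg hq0.le t])
  have hnn : (2 * (k * t) + 1 : ℝ) < n := by
    have h1 : (0 : ℝ) ≤ 2 * (n * (δ / q)) := by positivity
    have h2 : (0 : ℝ) ≤ k * ∑ r ∈ range t, q ^ (t - 1 - r) * d r :=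
      mul_nonneg (Nat.cast_nonneg _) (Finset.sum_nonneg fun r _ =>
        mul_nonneg (pow_nonneg hq0.le _) (hd r))
    have h3 : (n : ℝ) * (1 - q ^ t) ^ k ≤ n * 1 := by gcongr
    linarith
  have hn' : 2 * (k * t) + 1 < n := by exact_mod_cast hnn
  have hnotall : ∀ (e : ℕ) (c : Position (Fin n ⊕ Fin n) k) (l : Fin k → ℕ) (J : Finset (Fin k)),
      e ≤ 1 → BreakerInv E q t d e c l J → ¬ ∀ v, c v ≠ none := by
    intro e c l J he h hall
    have h1 : (usedL c).card = n := by
      rw [usedL, Finset.filter_true_of_mem fun y _ => hall _]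
      simp
    have h2 := sum_le_mul h
    have h3 := h.used
    omega
  induction m with
  | zero =>
    intro c l J hm h hwin
    cases hwin with
    | finished _ _ hall => exact hnotall 0 c l J (by omega) h hall
    | maker _ v i hleg hw =>
      obtain ⟨J', h', hothers, hmany⟩ := h.maker_move hq0.le hq1 (i := i) hleg.1
      cases hw with
      | finished _ _ hall => exact hnotall 1 _ l J' le_rfl h' hall
      | breaker _ hst _ =>
        refine hst (h'.stuck hE hq0 hq1 hx hd hfin fun j _ => ?_)
        by_contra hne
        have hlt : ∑ i, l i < ∑ i : Fin k, t := Finset.sum_lt_sum (fun i _ => h.le i)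
          ⟨j, mem_univ j, lt_of_le_of_ne (h.le j) hne⟩
        simp only [sum_const, card_univ, Fintype.card_fin, smul_eq_mul] at hlt
        omega
  | succ m ih =>
    intro c l J hm h hwin
    cases hwin with
    | finished _ _ hall => exact hnotall 0 c l J (by omega) h hall
    | maker _ v i hleg hw =>
      obtain ⟨J', h', hothers, hmany⟩ := h.maker_move hq0.le hq1 (i := i) hleg.1
      cases hw with
      | finished _ _ hall => exact hnotall 1 _ l J' le_rfl h' hall
      | breaker _ hst hall =>
        by_cases hclosed : ∀ j, j ∉ J' → l j = t
        · exact hst (h'.stuck hE hq0 hq1 hx hd hfin hclosed)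
        -- answer with Maker's color if it is open, and with any open color otherwise
        have : ∃ j, j ∉ J' ∧ l j < t ∧ ∀ j', j' ∉ J' → l j' < t → j' ≠ j →
            (colorR (play c v i) j').card ≤ l j' := by
          by_cases hi : i ∉ J' ∧ l i < t
          · exact ⟨i, hi.1, hi.2, hothers⟩
          · push Not at hclosed
            obtain ⟨j, hj, hj'⟩ := hclosed
            refine ⟨j, hj, lt_of_le_of_ne (h.le j) hj', fun j' h1 h2 _ => hothers j' h1 h2 ?_⟩
            rintro rfl
            exact hi ⟨h1, h2⟩
        obtain ⟨j, hj, hjt, hj'⟩ := this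
        obtain ⟨z, hzleg, hinv⟩ := h'.breaker_move hE (by omega) hq0 hq1 hj hjt hj'
          (hmany j hj hjt)
        refine ih _ _ _ ?_ hinv (hall _ _ hzleg)
        have : ∑ i, Function.update l j (l j + 1) i = ∑ i, l i + 1 :=
          sum_comp_update_succ (fun r => r) l j rfl
        omega

/-- Breaker wins on pseudorandom bipartite graphs. -/
theorem not_makerWins_of_pseudorandom (hE : Pseudorandom E q k t x δ d) (hq0 : 0 < q) (hq1 : q ≤ 1)
    (hx : 2 * (k * t) + 1 ≤ x) (hδ : 0 ≤ δ) (hd : ∀ r, 0 ≤ d r)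
    (hfin : 2 * (n * (δ / q)) + (2 * (k * t) + 1) + k * ∑ r ∈ range t, q ^ (t - 1 - r) * d r <
      n * (1 - q ^ t) ^ k) :
    ¬ MakerWins (bipartiteGraph (E : Set (Fin n × Fin n))) .maker
      (fun _ => none : Position (Fin n ⊕ Fin n) k) := by
  refine BreakerInv.not_makerWins hE hq0 hq1 hx hδ hd hfin (k * t) _ (fun _ => 0) ∅ (by simp) ?_
  refine ⟨by simp, by simp, by simp [colorR], by simp, by simp [usedL, usedR], ?_⟩
  simp [potential, factor, freeR, colorL]

end Strategy

end RandomBipartite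

/-! ### Binomial random subsets of a finite set -/

namespace RandomBipartite

open Finset

section RandomSubset

variable {ι κ : Type*} [Fintype ι] [DecidableEq ι]

/-- The probability that a random subset of `ι`, in which each element is absent independently with
probability `q`, equals `E`. -/
noncomputable def weight (q : ℝ) (E : Finset ι) : ℝ := (1 - q) ^ E.card * q ^ Eᶜ.card

/-- The expectation of `f` evaluated at the random subset. -/
noncomputable def expect (q : ℝ) (f : Finset ι → ℝ) : ℝ := ∑ E, weight q E * f E

open Classical in
/-- The probability that the random subset has the property `P`. -/
noncomputable def pr (q : ℝ) (P : Finset ι → Prop) : ℝ := expect q fun E => if P E then 1 else 0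

variable {q : ℝ}

theorem weight_nonneg (hq0 : 0 ≤ q) (hq1 : q ≤ 1) (E : Finset ι) : 0 ≤ weight q E :=
  mul_nonneg (pow_nonneg (by linarith) _) (pow_nonneg hq0 _)

theorem expect_mono (hq0 : 0 ≤ q) (hq1 : q ≤ 1) {f g : Finset ι → ℝ} (h : ∀ E, f E ≤ g E) :
    expect q f ≤ expect q g :=
  Finset.sum_le_sum fun E _ => mul_le_mul_of_nonneg_left (h E) (weight_nonneg hq0 hq1 E)

theorem expect_const_mul (a : ℝ) (f : Finset ι → ℝ) :
    expect q (fun E => a * f E) = a * expect q f := by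
  simp only [expect, Finset.mul_sum]
  exact Finset.sum_congr rfl fun E _ => by ring

theorem expect_sum (s : Finset κ) (f : κ → Finset ι → ℝ) :
    expect q (fun E => ∑ a ∈ s, f a E) = ∑ a ∈ s, expect q (f a) := by
  simp only [expect, Finset.mul_sum]
  exact Finset.sum_comm

theorem expect_disjoint (U : Finset ι) :
    expect q (fun E => if Disjoint E U then 1 else 0) = q ^ U.card := by
  have h : ∀ E : Finset ι, Disjoint E U ↔ E ∈ Uᶜ.powerset := fun E => by
    rw [Finset.mem_powerset, Finset.subset_compl_iff_disjoint_right]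
  simp only [expect, h, mul_ite, mul_one, mul_zero]
  rw [← Finset.sum_filter, Finset.filter_mem_eq_inter, Finset.univ_inter]
  have h2 : ∀ E ∈ Uᶜ.powerset, weight q E =
      q ^ U.card * ((1 - q) ^ E.card * q ^ (Uᶜ.card - E.card)) := by
    intro E hE
    have h3 := Finset.card_le_card (Finset.mem_powerset.1 hE)
    have h4 := Finset.card_le_univ U
    rw [weight, mul_left_comm, ← pow_add]
    congr 2
    rw [Finset.card_compl] at h3 ⊢
    rw [Finset.card_compl]
    omega
  rw [Finset.sum_congr rfl h2, ← Finset.mul_sum, Finset.sum_pow_mul_eq_add_pow]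
  simp

/-- The generating function of the number of disjoint blocks avoided by the random subset. -/
theorem expect_prod_disjoint (s : Finset κ) (B : κ → Finset ι)
    (hB : (s : Set κ).PairwiseDisjoint B) (y : ℝ) :
    expect q (fun E => ∏ j ∈ s, if Disjoint E (B j) then y else 1) =
      ∏ j ∈ s, (1 + (y - 1) * q ^ (B j).card) := by
  classical
  have h1 : ∀ E : Finset ι, (∏ j ∈ s, if Disjoint E (B j) then y else 1) =
      ∑ u ∈ s.powerset, (y - 1) ^ u.card * if Disjoint E (u.biUnion B) then 1 else 0 := by
    intro E
    have : ∀ j ∈ s, (if Disjoint E (B j) then y else 1) =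
        1 + if Disjoint E (B j) then y - 1 else 0 := by
      intro j _
      split_ifs <;> ring
    rw [Finset.prod_congr rfl this, Finset.prod_one_add]
    refine Finset.sum_congr rfl fun u _ => ?_
    simp only [Finset.disjoint_biUnion_right]
    by_cases h : ∀ j ∈ u, Disjoint E (B j)
    · rw [Finset.prod_congr rfl fun j hj => if_pos (h j hj)]
      simp only [prod_const, mul_ite, mul_one, mul_zero]
      rw [if_pos h]
    · rw [if_neg h, mul_zero]
      push Not at h
      obtain ⟨j, hj, hj'⟩ := h
      exact Finset.prod_eq_zero hj (if_neg hj')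
  simp only [h1]
  rw [expect_sum, Finset.prod_one_add]
  refine Finset.sum_congr rfl fun u hu => ?_
  rw [expect_const_mul, expect_disjoint, Finset.card_biUnion fun a ha b hb hab =>
    hB (Finset.mem_powerset.1 hu ha) (Finset.mem_powerset.1 hu hb) hab, Finset.prod_mul_distrib,
    Finset.prod_const, Finset.prod_pow_eq_pow_sum]

theorem expect_one : expect q (fun _ : Finset ι => 1) = 1 := by
  have := expect_disjoint (q := q) (∅ : Finset ι)
  simpa using this

theorem pr_nonneg (hq0 : 0 ≤ q) (hq1 : q ≤ 1) (P : Finset ι → Prop) : 0 ≤ pr q P :=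
  Finset.sum_nonneg fun E _ => mul_nonneg (weight_nonneg hq0 hq1 E) (by dsimp only; split_ifs <;> norm_num)

theorem pr_le_expect (hq0 : 0 ≤ q) (hq1 : q ≤ 1) {P : Finset ι → Prop} {f : Finset ι → ℝ}
    (hf : ∀ E, 0 ≤ f E) (h : ∀ E, P E → 1 ≤ f E) : pr q P ≤ expect q f := by
  refine expect_mono hq0 hq1 fun E => ?_
  split_ifs with hE
  · exact h E hE
  · exact hf E

theorem pr_le_sum (hq0 : 0 ≤ q) (hq1 : q ≤ 1) {P : Finset ι → Prop} (s : Finset κ)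
    (Q : κ → Finset ι → Prop) (h : ∀ E, P E → ∃ a ∈ s, Q a E) :
    pr q P ≤ ∑ a ∈ s, pr q (Q a) := by
  classical
  rw [show ∑ a ∈ s, pr q (Q a) = expect q (fun E => ∑ a ∈ s, if Q a E then (1 : ℝ) else 0) from
    (expect_sum s _).symm]
  refine pr_le_expect hq0 hq1 (fun E => Finset.sum_nonneg fun a _ => by split_ifs <;> norm_num) ?_
  intro E hE
  obtain ⟨a, ha, hQ⟩ := h E hE
  refine le_trans ?_ (Finset.single_le_sum (f := fun a => if Q a E then (1 : ℝ) else 0)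
    (fun a _ => by split_ifs <;> norm_num) ha)
  simp [hQ]

/-- The union bound for a family of events of equal probability bound. -/
theorem pr_le_card_mul (hq0 : 0 ≤ q) (hq1 : q ≤ 1) {P : Finset ι → Prop} (s : Finset κ)
    (Q : κ → Finset ι → Prop) {M b : ℝ} (h : ∀ E, P E → ∃ a ∈ s, Q a E) (hM : (s.card : ℝ) ≤ M)
    (hb0 : 0 ≤ b) (hb : ∀ a ∈ s, pr q (Q a) ≤ b) : pr q P ≤ M * b := by
  refine (pr_le_sum hq0 hq1 s Q h).trans ((Finset.sum_le_card_nsmul s _ b hb).trans ?_)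
  rw [nsmul_eq_mul]
  gcongr

theorem pr_mono (hq0 : 0 ≤ q) (hq1 : q ≤ 1) {P Q : Finset ι → Prop} (h : ∀ E, P E → Q E) :
    pr q P ≤ pr q Q := by
  classical
  refine expect_mono hq0 hq1 fun E => ?_
  by_cases hP : P E
  · simp [hP, h E hP]
  · simp only [hP, if_false]
    split_ifs <;> norm_num

theorem pr_or_le (hq0 : 0 ≤ q) (hq1 : q ≤ 1) {P Q R : Finset ι → Prop}
    (h : ∀ E, P E → Q E ∨ R E) : pr q P ≤ pr q Q + pr q R := by
  have := pr_le_sum hq0 hq1 (P := P) (univ : Finset Bool) (fun b => bif b then Q else R)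
    fun E hE => by
      rcases h E hE with h | h
      · exact ⟨true, mem_univ _, h⟩
      · exact ⟨false, mem_univ _, h⟩
  simpa using this

theorem pr_add_pr_not (P : Finset ι → Prop) : pr q P + pr q (fun E => ¬ P E) = 1 := by
  classical
  rw [← expect_one (q := q) (ι := ι), pr, pr, expect, expect, expect, ← Finset.sum_add_distrib]
  refine Finset.sum_congr rfl fun E _ => ?_
  by_cases hP : P E <;> simp [hP]

/-- Exponential tail bound, for both tails, for the number of disjoint blocks that the random subset
avoids. -/
theorem pr_avoided_le (hq0 : 0 ≤ q) (hq1 : q ≤ 1) (s : Finset κ) (B : κ → Finset ι)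
    (hB : (s : Set κ).PairwiseDisjoint B) (a m : ℝ) :
    pr q (fun E => 0 ≤ a * (((s.filter fun j => Disjoint E (B j)).card : ℝ) - m)) ≤
      Real.exp (-a * m + (Real.exp a - 1) * ∑ j ∈ s, q ^ (B j).card) := by
  have h1 : ∀ E : Finset ι, (∏ j ∈ s, if Disjoint E (B j) then Real.exp a else 1) =
      Real.exp (a * ((s.filter fun j => Disjoint E (B j)).card : ℝ)) := by
    intro E
    rw [Finset.prod_ite, Finset.prod_const, Finset.prod_const_one, mul_one, ← Real.exp_nat_mul,
      mul_comm]
  refine (pr_le_expect hq0 hq1 (f := fun E => Real.exp (-a * m) *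
    ∏ j ∈ s, if Disjoint E (B j) then Real.exp a else 1) (fun E => ?_) fun E hE => ?_).trans ?_
  · rw [h1]; positivity
  · rw [h1, ← Real.exp_add, Real.one_le_exp_iff]
    linarith
  · rw [expect_const_mul, expect_prod_disjoint s B hB, Real.exp_add, Finset.mul_sum, Real.exp_sum]
    refine mul_le_mul_of_nonneg_left (Finset.prod_le_prod (fun j _ => ?_) fun j _ => ?_)
      (Real.exp_pos _).le
    · have h2 := pow_nonneg hq0 (B j).card
      have h3 := pow_le_one₀ hq0 hq1 (n := (B j).card)
      nlinarith [Real.exp_pos a]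
    · rw [add_comm]
      exact Real.add_one_le_exp _

/-- Exponential tail bound, for both tails, for the number of elements of `Q` in the random
subset. -/
theorem pr_card_inter_le (hq0 : 0 ≤ q) (hq1 : q ≤ 1) (Q : Finset ι) (a m : ℝ) :
    pr q (fun E => 0 ≤ a * (((Q.filter fun e => e ∈ E).card : ℝ) - m)) ≤
      Real.exp (-a * m + (Real.exp a - 1) * (1 - q) * Q.card) := by
  have h1 : ∀ E : Finset ι, Real.exp (a * ((Q.filter fun e => e ∈ E).card : ℝ)) =
      Real.exp a ^ Q.card * ∏ e ∈ Q, if Disjoint E {e} then Real.exp (-a) else 1 := by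
    intro E
    rw [← Finset.prod_const, ← Finset.prod_mul_distrib]
    have : ∀ e ∈ Q, (Real.exp a * if Disjoint E {e} then Real.exp (-a) else 1) =
        if e ∈ E then Real.exp a else 1 := by
      intro e _
      by_cases h : e ∈ E <;> simp [h, ← Real.exp_add]
    rw [Finset.prod_congr rfl this, Finset.prod_ite, Finset.prod_const, Finset.prod_const_one,
      mul_one, ← Real.exp_nat_mul, mul_comm]
  refine (pr_le_expect hq0 hq1 (f := fun E => Real.exp (-a * m) *
    (Real.exp a ^ Q.card * ∏ e ∈ Q, if Disjoint E {e} then Real.exp (-a) else 1))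
    (fun E => ?_) fun E hE => ?_).trans ?_
  · rw [← h1]; positivity
  · rw [← h1, ← Real.exp_add, Real.one_le_exp_iff]
    linarith
  · rw [expect_const_mul, expect_const_mul, expect_prod_disjoint Q (fun e => {e})
      (fun e _ f _ hef => by simpa using hef), Real.exp_add]
    simp only [card_singleton, pow_one, prod_const]
    rw [← mul_pow, mul_comm _ (Q.card : ℝ), Real.exp_nat_mul]
    have h2 : Real.exp a * (1 + (Real.exp (-a) - 1) * q) = (Real.exp a - 1) * (1 - q) + 1 := by
      have : Real.exp a * Real.exp (-a) = 1 := by rw [← Real.exp_add]; simp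
      linear_combination q * this
    rw [h2]
    gcongr
    · nlinarith [Real.exp_pos a]
    · exact Real.add_one_le_exp _

end RandomSubset

/-- The probability space of the random bipartite graph as a finite sum. -/
theorem prob_eq_pr (n : ℕ) (p : unitInterval) (P : SimpleGraph (Fin n ⊕ Fin n) → Prop) :
    prob n p P = ENNReal.ofReal
      (pr (1 - (p : ℝ)) fun E : Finset (Fin n × Fin n) => P (bipartiteGraph (E : Set (Fin n × Fin n)))) := by
  classical
  rw [prob, ← ENNReal.ofReal_toReal (measure_ne_top _ _)]
  congr 1
  change (setBernoulli Set.univ p).real _ = _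
  have hU : {E : Set (Fin n × Fin n) | P (bipartiteGraph E)} =
      ⋃ F ∈ (univ.filter fun F : Finset (Fin n × Fin n) => P (bipartiteGraph F)),
        {(F : Set (Fin n × Fin n))} := by
    ext E
    simp only [Set.mem_ofPred_eq, Finset.mem_filter, Finset.mem_univ, true_and, Set.mem_iUnion,
      Set.mem_singleton_iff, exists_prop]
    constructor
    · intro h
      exact ⟨E.toFinset, by simpa using h, by simp⟩
    · rintro ⟨F, hF, rfl⟩
      exact hF
  rw [hU, measureReal_biUnion_finset _ (fun _ _ => MeasurableSet.of_discrete)]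
  · rw [pr, expect, Finset.sum_filter]
    refine Finset.sum_congr rfl fun F _ => ?_
    rw [setBernoulli_real_singleton p (Set.subset_univ _) Set.finite_univ, weight,
      Set.ncard_coe_finset, ← Set.compl_eq_univ_sdiff, ← Finset.coe_compl, Set.ncard_coe_finset]
    split_ifs <;> simp
  · intro F _ F' _ h
    simpa [Function.onFun] using h

theorem whp_of_pr_not_le (p : ℕ → unitInterval) (P : ∀ n : ℕ, SimpleGraph (Fin n ⊕ Fin n) → Prop)
    (h : ∀ ε > 0, ∀ᶠ n in atTop, pr (1 - (p n : ℝ))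
      (fun E : Finset (Fin n × Fin n) => ¬ P n (bipartiteGraph (E : Set (Fin n × Fin n)))) ≤ ε) : Whp p P := by
  have hlim : Tendsto (fun n => pr (1 - (p n : ℝ))
      (fun E : Finset (Fin n × Fin n) => P n (bipartiteGraph (E : Set (Fin n × Fin n))))) atTop (𝓝 1) := by
    rw [Metric.tendsto_atTop']
    intro ε hε
    obtain ⟨N, hN⟩ := eventually_atTop.1 (h (ε / 2) (by positivity))
    refine ⟨N, fun n hn => ?_⟩
    have h1 := hN n hn.le
    have h2 := pr_add_pr_not (q := 1 - (p n : ℝ))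
      (fun E : Finset (Fin n × Fin n) => P n (bipartiteGraph (E : Set (Fin n × Fin n))))
    have h3 := pr_nonneg (q := 1 - (p n : ℝ)) (by linarith [(p n).2.2]) (by linarith [(p n).2.1])
      (fun E : Finset (Fin n × Fin n) => ¬ P n (bipartiteGraph (E : Set (Fin n × Fin n))))
    rw [Real.dist_eq, abs_lt]
    constructor <;> linarith
  have := ENNReal.tendsto_ofReal hlim
  rw [ENNReal.ofReal_one] at this
  exact this.congr fun n => (prob_eq_pr n (p n) (P n)).symm

end RandomBipartite

/-! ### Few vertices with few available colors, and sparse small sets -/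

namespace RandomBipartite

open Finset ColoringGame

variable {n k : ℕ} {q : ℝ}

/-- A lower bound for the expected number of available colors at a vertex, by convexity of
`m ↦ q ^ m`. -/
theorem mul_exp_le_sum_pow (hk : 0 < k) (hq0 : 0 < q) (hq1 : q ≤ 1) (φ : Fin n → Option (Fin k)) :
    k * Real.exp (Real.log q * n / k) ≤
      ∑ i, q ^ (univ.filter fun y => φ y = some i).card := by
  classical
  have hkR : (0 : ℝ) < k := by exact_mod_cast hk
  have hlog : Real.log q ≤ 0 := Real.log_nonpos hq0.le hq1
  set x₀ : ℝ := Real.log q * n / k with hx₀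
  have hsum : (∑ i, ((univ.filter fun y => φ y = some i).card : ℝ)) ≤ n := by
    have h1 : ∑ i, (univ.filter fun y => φ y = some i).card ≤ n := by
      rw [← Finset.card_biUnion]
      · exact (Finset.card_le_univ _).trans (by simp)
      · intro i _ j _ hij
        refine Finset.disjoint_left.2 fun y hy hy' => ?_
        simp only [mem_filter, mem_univ, true_and] at hy hy'
        rw [hy] at hy'
        exact hij (Option.some.inj hy')
    exact_mod_cast h1
  have h : ∀ i ∈ (univ : Finset (Fin k)), Real.exp x₀ *
      (1 + (Real.log q * ((univ.filter fun y => φ y = some i).card : ℝ) - x₀)) ≤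
      q ^ (univ.filter fun y => φ y = some i).card := by
    intro i _
    set m := (univ.filter fun y => φ y = some i).card
    have h1 : q ^ m = Real.exp x₀ * Real.exp (Real.log q * m - x₀) := by
      rw [← Real.exp_add, add_sub_cancel, mul_comm, Real.exp_nat_mul, Real.exp_log hq0]
    rw [h1, add_comm]
    gcongr
    exact Real.add_one_le_exp _
  refine le_trans ?_ (Finset.sum_le_sum h)
  rw [← Finset.mul_sum, mul_comm]
  gcongr
  rw [Finset.sum_add_distrib, Finset.sum_sub_distrib, ← Finset.mul_sum]
  simp only [sum_const, card_univ, Fintype.card_fin, nsmul_eq_mul, mul_one]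
  have h2 : (k : ℝ) * x₀ = Real.log q * n := by rw [hx₀]; field_simp
  rw [h2]
  nlinarith

/-- The block of possible edges, transported by `e`, between `x` and a set of vertices. Taking for
`e` the identity or the swap of coordinates, one treats both parts of the graph at once. -/
def block (e : Fin n × Fin n ≃ Fin n × Fin n) (x : Fin n) (S : Finset (Fin n)) :
    Finset (Fin n × Fin n) := ({x} ×ˢ S).map e.toEmbedding

theorem card_block (e : Fin n × Fin n ≃ Fin n × Fin n) (x : Fin n) (S : Finset (Fin n)) :
    (block e x S).card = S.card := by
  simp [block]

theorem disjoint_block_iff (e : Fin n × Fin n ≃ Fin n × Fin n) (x : Fin n) (S : Finset (Fin n))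
    (E : Finset (Fin n × Fin n)) : Disjoint E (block e x S) ↔ ∀ y ∈ S, e (x, y) ∉ E := by
  rw [Finset.disjoint_right]
  simp only [block, Finset.mem_map, mem_product, mem_singleton, Equiv.coe_toEmbedding, Prod.exists,
    forall_exists_index, and_imp]
  constructor
  · intro h y hy
    exact h x y rfl hy rfl
  · rintro h _ _ y rfl hy rfl
    exact h y hy

theorem disjoint_block_block (e : Fin n × Fin n ≃ Fin n × Fin n) {x x' : Fin n}
    {S S' : Finset (Fin n)} (h : x ≠ x' ∨ Disjoint S S') :
    Disjoint (block e x S) (block e x' S') := by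
  rw [block, block, Finset.disjoint_map, Finset.disjoint_product]
  exact h.imp (fun h => by simpa using h) id

/-- It is unlikely that some partial coloring `φ` of one part leaves `γ` vertices of the other part
with fewer than half the expected number of available colors. For fixed `φ` and a fixed set of `γ`
vertices, the numbers in question are sums over independent blocks of edges; the first factor
counts the choices of `φ` and of this set. -/
theorem pr_few_available (e : Fin n × Fin n ≃ Fin n × Fin n) (hk : 0 < k) (hq0 : 0 < q)
    (hq1 : q ≤ 1) (β : ℝ) (hβ0 : 0 ≤ β) (hβ : β ≤ k * Real.exp (Real.log q * n / k)) (γ : ℕ) :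
    pr q (fun E => ∃ φ : Fin n → Option (Fin k), γ ≤ (univ.filter fun x : Fin n =>
      ((univ.filter fun i : Fin k => ∀ y, φ y = some i → e (x, y) ∉ E).card : ℝ) < β / 2).card) ≤
      ((k + 1) ^ n * 2 ^ n) * Real.exp (-(γ * β / 8)) := by
  classical
  refine pr_le_card_mul hq0.le hq1
    (univ : Finset ((Fin n → Option (Fin k)) × Finset (Fin n)))
    (fun a E => a.2.card = γ ∧ ∀ x ∈ a.2,
      ((univ.filter fun i : Fin k => ∀ y, a.1 y = some i → e (x, y) ∉ E).card : ℝ) < β / 2)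
    ?_ (by simp) (by positivity) ?_
  · rintro E ⟨φ, hφ⟩
    obtain ⟨T, hT, hTc⟩ := Finset.exists_subset_card_eq hφ
    exact ⟨(φ, T), mem_univ _, hTc, fun x hx => (mem_filter.1 (hT hx)).2⟩
  · rintro ⟨φ, T⟩ -
    by_cases hT : T.card = γ
    swap
    · refine le_trans (le_of_eq ?_) (Real.exp_pos _).le
      simp [pr, expect, hT]
    let B : Fin n × Fin k → Finset (Fin n × Fin n) := fun a =>
      block e a.1 (univ.filter fun y => φ y = some a.2)
    have hB : ((T ×ˢ univ : Finset (Fin n × Fin k)) : Set (Fin n × Fin k)).PairwiseDisjoint B := by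
      rintro ⟨x, i⟩ _ ⟨x', i'⟩ _ hne
      refine disjoint_block_block e ?_
      by_cases hx : x = x'
      · subst hx
        refine Or.inr ?_
        rw [Finset.disjoint_left]
        intro y hy hy'
        simp only [mem_filter, mem_univ, true_and] at hy hy'
        rw [hy] at hy'
        exact hne (by rw [Option.some.inj hy'])
      · exact Or.inl hx
    refine (pr_mono hq0.le hq1 ?_).trans ((pr_avoided_le hq0.le hq1 (T ×ˢ univ) B hB (-1)
      (γ * (β / 2))).trans ?_)
    · rintro E ⟨-, hE⟩
      have h1 : ((((T ×ˢ univ : Finset (Fin n × Fin k)).filter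
          fun a => Disjoint E (B a)).card : ℝ)) = ∑ x ∈ T,
          ((univ.filter fun i : Fin k => ∀ y, φ y = some i → e (x, y) ∉ E).card : ℝ) := by
        rw [Finset.card_filter, Finset.sum_product]
        push_cast
        refine Finset.sum_congr rfl fun x _ => ?_
        rw [Finset.card_filter]
        push_cast
        refine Finset.sum_congr rfl fun i _ => ?_
        simp [B, disjoint_block_iff]
      have h2 := Finset.sum_le_card_nsmul T _ (β / 2) fun x hx => (hE x hx).le
      rw [nsmul_eq_mul, hT] at h2
      rw [h1]
      linarith
    · rw [Real.exp_le_exp]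
      have h1 : (γ : ℝ) * β ≤ ∑ a ∈ (T ×ˢ univ : Finset (Fin n × Fin k)), q ^ (B a).card := by
        rw [Finset.sum_product]
        have : ∀ x ∈ T, β ≤ ∑ i : Fin k, q ^ (B (x, i)).card := fun x _ => by
          simp only [B, card_block]
          exact hβ.trans (mul_exp_le_sum_pow hk hq0 hq1 φ)
        have := Finset.card_nsmul_le_sum T _ β this
        rwa [nsmul_eq_mul, hT] at this
      have h2 : Real.exp (-1) ≤ 3 / 8 := by
        have := Real.exp_one_gt_d9
        rw [Real.exp_neg, inv_le_comm₀ (Real.exp_pos _) (by norm_num)]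
        linarith
      have h3 : 0 ≤ (γ : ℝ) * β := by positivity
      nlinarith

theorem choose_le_exp (N s : ℕ) (hs : 0 < s) (hN : 0 < N) :
    (N.choose s : ℝ) ≤ Real.exp (s * (Real.log N + 1 - Real.log s)) := by
  have hsR : (0 : ℝ) < s := by exact_mod_cast hs
  have hNR : (0 : ℝ) < N := by exact_mod_cast hN
  have h1 : (N.choose s : ℝ) ≤ (N : ℝ) ^ s / (s.factorial : ℝ) := Nat.choose_le_pow_div s N
  have h2 := Real.pow_div_factorial_le_exp (s : ℝ) hsR.le s
  have hf : (0 : ℝ) < s.factorial := by exact_mod_cast s.factorial_pos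
  have h3 : Real.exp (s * (Real.log N + 1 - Real.log s)) = N ^ s * Real.exp s / (s : ℝ) ^ s := by
    rw [show (s : ℝ) * (Real.log N + 1 - Real.log s) = s * Real.log N + s - s * Real.log s by ring,
      Real.exp_sub, Real.exp_add, Real.exp_nat_mul, Real.exp_nat_mul, Real.exp_log hNR,
      Real.exp_log hsR]
  rw [h3]
  refine h1.trans ?_
  rw [div_le_div_iff₀ hf (by positivity), mul_assoc]
  gcongr
  rwa [div_le_iff₀ hf] at h2

theorem sum_range_succ_pow_le {r : ℝ} (hr0 : 0 ≤ r) (hr : r ≤ 1 / 2) (m : ℕ) :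
    ∑ s ∈ range m, r ^ (s + 1) ≤ 2 * r := by
  have h : ∑ s ∈ range m, r ^ (s + 1) ≤ 2 * r - 2 * r ^ (m + 1) := by
    induction m with
    | zero => simp
    | succ m ih =>
      rw [Finset.sum_range_succ]
      have h1 : r ^ (m + 1 + 1) ≤ r ^ (m + 1) * (1 / 2) := by
        rw [pow_succ]
        gcongr
      linarith
  linarith [pow_nonneg hr0 (m + 1)]

/-- It is unlikely that some vertex set `S` spans more than `2 * (|S| * p + log (n * p)) * |S|` edges,
where `p = 1 - q`. -/
theorem pr_dense_subset (hn : 0 < n) (hq0 : 0 ≤ q) (hq1 : q < 1)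
    (hL : 2 ≤ Real.log (n * (1 - q))) :
    pr q (fun E => ∃ S : Finset (Fin n ⊕ Fin n),
      2 * (S.card * (1 - q) + Real.log (n * (1 - q))) * S.card <
        (((S.toLeft ×ˢ S.toRight).filter fun e => e ∈ E).card : ℝ)) ≤
      2 * Real.exp (-Real.log (n * (1 - q))) := by
  classical
  set p := 1 - q with hp
  set L := Real.log (n * p) with hLdef
  have hp0 : 0 < p := by linarith
  have hnR : (0 : ℝ) < n := by exact_mod_cast hn
  have key : ∀ S : Finset (Fin n ⊕ Fin n), 0 < S.card →
      pr q (fun E => 2 * (S.card * p + L) * S.card <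
        (((S.toLeft ×ˢ S.toRight).filter fun e => e ∈ E).card : ℝ)) ≤
      Real.exp (S.card * (Real.log (S.card * p) + 2 - 3 * L - L - 2 * S.card * p)) := by
    intro S hS
    set s : ℝ := (S.card : ℝ) with hs
    have hs0 : 0 < s := by rw [hs]; exact_mod_cast hS
    have hsp : 0 < s * p := by positivity
    set D := 2 * (s * p + L) with hD
    -- The parameter of the exponential tail bound. Up to constants `exp a` is the larger one of `1`
    -- and the ratio `1 / (s * p)`, which beats the number of choices of `S` if `s * p` is small.
    set a := 2 + Real.log (1 + 1 / (s * p)) with ha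
    have hlog0 : 0 ≤ Real.log (1 + 1 / (s * p)) := Real.log_nonneg (by
      have : 0 < 1 / (s * p) := by positivity
      linarith)
    have hlog1 : -Real.log (s * p) ≤ Real.log (1 + 1 / (s * p)) := by
      rw [← Real.log_inv]
      refine Real.log_le_log (by positivity) ?_
      rw [one_div]
      linarith
    have hexp : Real.exp a = Real.exp 2 * (1 + 1 / (s * p)) := by
      rw [ha, Real.exp_add, Real.exp_log (by positivity)]
    have hexp2 : Real.exp 2 ≤ 8 := by
      rw [show (2 : ℝ) = 1 + 1 by norm_num, Real.exp_add]
      nlinarith [Real.exp_one_lt_d9, Real.exp_pos 1]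
    have hcard : ((S.toLeft ×ˢ S.toRight).card : ℝ) ≤ s ^ 2 / 4 := by
      rw [Finset.card_product, hs, ← Finset.card_toLeft_add_card_toRight (u := S)]
      push_cast
      nlinarith [sq_nonneg ((S.toLeft.card : ℝ) - S.toRight.card)]
    refine (pr_mono hq0 hq1.le ?_).trans ((pr_card_inter_le hq0 hq1.le (S.toLeft ×ˢ S.toRight) a
      (D * s)).trans ?_)
    · intro E hE
      exact mul_nonneg (by linarith) (by linarith)
    · rw [Real.exp_le_exp, ← hp]
      have h1 : (Real.exp a - 1) * p * ((S.toLeft ×ˢ S.toRight).card : ℝ) ≤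
          2 * (s ^ 2 * p + s) := by
        calc (Real.exp a - 1) * p * ((S.toLeft ×ˢ S.toRight).card : ℝ)
            ≤ Real.exp a * p * (s ^ 2 / 4) := by gcongr; linarith
          _ ≤ 8 * (1 + 1 / (s * p)) * p * (s ^ 2 / 4) := by rw [hexp]; gcongr
          _ = 2 * (s ^ 2 * p + s) := by field_simp; ring
      have h2 : s * (-Real.log (s * p)) ≤ D * s * Real.log (1 + 1 / (s * p)) := by
        calc s * (-Real.log (s * p)) ≤ s * Real.log (1 + 1 / (s * p)) := by gcongr
          _ = 1 * s * Real.log (1 + 1 / (s * p)) := by ring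
          _ ≤ D * s * Real.log (1 + 1 / (s * p)) := by
            gcongr
            linarith
      have h3 : -a * (D * s) = -(2 * D * s) - D * s * Real.log (1 + 1 / (s * p)) := by
        rw [ha]; ring
      have h4 : 2 * D * s = 4 * (s ^ 2 * p + s * L) := by rw [hD]; ring
      rw [h3, h4]
      nlinarith
  refine (pr_le_sum hq0 hq1.le ((univ : Finset (Fin n ⊕ Fin n)).powerset.filter
    fun S => 0 < S.card) (fun S E => 2 * (S.card * p + L) * S.card <
      (((S.toLeft ×ˢ S.toRight).filter fun e => e ∈ E).card : ℝ)) ?_).trans ?_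
  · rintro E ⟨S, hS⟩
    refine ⟨S, mem_filter.2 ⟨by simp, ?_⟩, hS⟩
    rw [Finset.card_pos, Finset.nonempty_iff_ne_empty]
    rintro rfl
    have h0 : ((∅ : Finset (Fin n ⊕ Fin n)).toLeft ×ˢ
        (∅ : Finset (Fin n ⊕ Fin n)).toRight) = ∅ := by
      ext ⟨x, y⟩
      simp
    rw [h0] at hS
    simp at hS
  refine (Finset.sum_le_sum fun S hS => key S (mem_filter.1 hS).2).trans ?_
  rw [Finset.sum_filter]
  have h1 := Finset.sum_powerset_apply_card (x := (univ : Finset (Fin n ⊕ Fin n))) (fun s : ℕ => if 0 < s then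
    Real.exp (s * (Real.log (s * p) + 2 - 3 * L - L - 2 * s * p)) else 0)
  rw [h1, Finset.sum_range_succ']
  simp only [lt_self_iff_false, if_false, smul_zero, add_zero, Nat.succ_pos, if_true]
  have hr : Real.exp (-L) ≤ 1 / 2 := by
    rw [Real.exp_neg, inv_le_comm₀ (Real.exp_pos _) (by norm_num)]
    linarith [Real.add_one_le_exp L]
  refine le_trans (Finset.sum_le_sum fun s _ => ?_)
    (sum_range_succ_pow_le (Real.exp_pos _).le hr _)
  rw [nsmul_eq_mul, ← Real.exp_nat_mul]
  have hcard : (univ : Finset (Fin n ⊕ Fin n)).card = 2 * n := by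
    simp [two_mul]
  rw [hcard]
  refine (mul_le_mul_of_nonneg_right (choose_le_exp (2 * n) (s + 1) (Nat.succ_pos _) (by omega))
    (Real.exp_pos _).le).trans ?_
  rw [← Real.exp_add, Real.exp_le_exp]
  push_cast
  have hs0 : (0 : ℝ) < s + 1 := by positivity
  have e1 : Real.log (2 * n) = Real.log 2 + Real.log n :=
    Real.log_mul (by norm_num) hnR.ne'
  have e2 : Real.log ((s + 1) * p) = Real.log (s + 1) + Real.log p :=
    Real.log_mul hs0.ne' hp0.ne'
  have e3 : L = Real.log n + Real.log p := Real.log_mul hnR.ne' hp0.ne'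
  have e4 := Real.log_two_lt_d9
  rw [e1, e2, ← mul_add]
  have e5 : Real.log 2 + Real.log n + 1 - Real.log (s + 1) + (Real.log (s + 1) + Real.log p + 2 -
      3 * L - L - 2 * (s + 1) * p) ≤ -L := by
    have : 0 ≤ 2 * ((s : ℝ) + 1) * p := by positivity
    linarith
  nlinarith

end RandomBipartite

/-! ### Maker wins with high probability -/

namespace RandomBipartite

open Finset ColoringGame

variable {n k : ℕ} {q : ℝ}

open Classical in
theorem sum_inner_degree (E : Finset (Fin n × Fin n)) (S : Finset (Fin n ⊕ Fin n)) :
    ∑ v ∈ S, (S.filter fun w => (bipartiteGraph (E : Set (Fin n × Fin n))).Adj v w).card =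
      2 * ((S.toLeft ×ˢ S.toRight).filter fun e => e ∈ E).card := by
  have hdeg : ∀ v, (S.filter fun w => (bipartiteGraph (E : Set (Fin n × Fin n))).Adj v w).card =
      ∑ x ∈ S.toLeft, (if (bipartiteGraph (E : Set (Fin n × Fin n))).Adj v (.inl x) then 1 else 0) +
      ∑ y ∈ S.toRight,
        (if (bipartiteGraph (E : Set (Fin n × Fin n))).Adj v (.inr y) then 1 else 0) := by
    intro v
    rw [Finset.card_filter]
    conv_lhs => rw [← Finset.toLeft_disjSum_toRight (u := S)]
    rw [Finset.sum_disjSum]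
  conv_lhs => rw [← Finset.toLeft_disjSum_toRight (u := S)]
  rw [Finset.sum_disjSum, Finset.toLeft_disjSum_toRight]
  simp only [hdeg]
  have h1 : ((S.toLeft ×ˢ S.toRight).filter fun e => e ∈ E).card =
      ∑ x ∈ S.toLeft, ∑ y ∈ S.toRight, if (x, y) ∈ E then 1 else 0 := by
    rw [Finset.card_filter, Finset.sum_product]
  have h2 := Finset.sum_comm (s := S.toLeft) (t := S.toRight)
    (f := fun x y => if (x, y) ∈ E then 1 else 0)
  simp only [bipartiteGraph, if_false, Finset.sum_const_zero, zero_add, add_zero, Finset.mem_coe]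
  omega

open Classical in
/-- If `S` spans few edges, then few of its vertices have large degree in `S`. -/
theorem card_large_inner_degree_le (E : Finset (Fin n × Fin n)) (S : Finset (Fin n ⊕ Fin n))
    {D : ℝ} (hD : 0 < D)
    (hS : (((S.toLeft ×ˢ S.toRight).filter fun e => e ∈ E).card : ℝ) ≤ D * S.card) {g : ℕ}
    (hg : 16 * D ≤ g) :
    8 * (S.filter fun v => g ≤
      (S.filter fun w => (bipartiteGraph (E : Set (Fin n × Fin n))).Adj v w).card).card ≤
        S.card := by
  set W := S.filter fun v => g ≤
      (S.filter fun w => (bipartiteGraph (E : Set (Fin n × Fin n))).Adj v w).card with hW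
  have h1 : W.card * g ≤
      ∑ v ∈ S, (S.filter fun w => (bipartiteGraph (E : Set (Fin n × Fin n))).Adj v w).card := by
    refine le_trans ?_ (Finset.sum_le_sum_of_subset (Finset.filter_subset _ S : W ⊆ S))
    rw [← smul_eq_mul]
    exact Finset.card_nsmul_le_sum W _ g fun v hv => (mem_filter.1 hv).2
  rw [sum_inner_degree] at h1
  have h2 : (W.card : ℝ) * g ≤ 2 * (D * S.card) := by
    have : (W.card : ℝ) * g ≤
        2 * (((S.toLeft ×ˢ S.toRight).filter fun e => e ∈ E).card : ℝ) := by exact_mod_cast h1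
    linarith
  have h3 : (W.card : ℝ) * (16 * D) ≤ W.card * g := by gcongr
  have h4 : D * (8 * W.card) ≤ D * (S.card : ℝ) := by linarith
  exact_mod_cast le_of_mul_le_mul_left h4 hD

/-- If in each part there are fewer than `γ` vertices with few available colors, then there are at
most `2 * γ` in total. The colors available in one part only depend on the coloring of the other
part. -/
theorem card_few_available_le (E : Finset (Fin n × Fin n)) (c : Position (Fin n ⊕ Fin n) k)
    {A : ℝ} {γ : ℕ}
    (hL : (univ.filter fun x : Fin n => ((univ.filter fun i : Fin k =>
      ∀ y, c (.inr y) = some i → (x, y) ∉ E).card : ℝ) < A).card < γ)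
    (hR : (univ.filter fun y : Fin n => ((univ.filter fun i : Fin k =>
      ∀ x, c (.inl x) = some i → (x, y) ∉ E).card : ℝ) < A).card < γ) :
    (univ.filter fun v =>
      (avail (bipartiteGraph (E : Set (Fin n × Fin n))) c v).card < ⌈A⌉₊).card ≤ 2 * γ := by
  classical
  have h1 : ∀ x, avail (bipartiteGraph (E : Set (Fin n × Fin n))) c (.inl x) =
      univ.filter fun i : Fin k => ∀ y, c (.inr y) = some i → (x, y) ∉ E := by
    intro x
    ext i
    simp only [avail, mem_filter, mem_univ, true_and, Sum.forall, bipartiteGraph, Finset.mem_coe]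
    constructor
    · exact fun h y hy hxy => h.2 y hxy hy
    · exact fun h => ⟨fun _ h' => h'.elim, fun y hxy hy => h y hy hxy⟩
  have h2 : ∀ y, avail (bipartiteGraph (E : Set (Fin n × Fin n))) c (.inr y) =
      univ.filter fun i : Fin k => ∀ x, c (.inl x) = some i → (x, y) ∉ E := by
    intro y
    ext i
    simp only [avail, mem_filter, mem_univ, true_and, Sum.forall, bipartiteGraph, Finset.mem_coe]
    constructor
    · exact fun h x hx hxy => h.1 x hxy hx
    · exact fun h => ⟨fun x hxy hx => h x hx hxy, fun _ h' => h'.elim⟩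
  rw [Finset.card_filter, Fintype.sum_sum_type, ← Finset.card_filter, ← Finset.card_filter]
  simp only [h1, h2, Nat.lt_ceil]
  omega

theorem sum_range_two_pow_le (j : ℕ) : ∑ i ∈ range (j + 1), (2 : ℝ) ^ i ≤ 2 * 2 ^ j := by
  induction j with
  | zero => norm_num
  | succ j ih =>
    rw [Finset.sum_range_succ, pow_succ]
    linarith

/-- If the number `k` of colors satisfies some numerical conditions, then Maker wins with `k` colors
except with small probability. Here `β` is a lower bound for the expected number of available colors
at a vertex in any partial coloring, and `γ` bounds the number of exceptional vertices in each
part. -/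
theorem pr_gameChromaticNumber_gt_le (hn : 0 < n) (hk : 0 < k) (hq0 : 0 < q) (hq1 : q < 1)
    {L β : ℝ} (hLdef : L = Real.log (n * (1 - q))) (hL : 2 ≤ L)
    (hβ : β = k * Real.exp (Real.log q * n / k)) {γ : ℕ} (hγn : γ + 1 ≤ n)
    (hkL : Real.log (k + 1) + Real.log 2 ≤ L) (hγ : 2 * n * L ≤ γ * β / 8)
    (hβγ : 17 + 1024 * ((γ + 1) * (1 - q)) + (32 * L + 1) * (2 * Real.log n + 1) ≤ β / 2) :
    pr q (fun E : Finset (Fin n × Fin n) =>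
      ¬ gameChromaticNumber (bipartiteGraph (E : Set (Fin n × Fin n))) ≤ k) ≤
      4 * Real.exp (-L) := by
  classical
  have hnR : (1 : ℝ) ≤ n := by exact_mod_cast hn
  have hkR : (0 : ℝ) < k := by exact_mod_cast hk
  have hp0 : 0 < 1 - q := by linarith
  have hβ0 : 0 ≤ β := by rw [hβ]; positivity
  have hβk : β ≤ k := by
    rw [hβ]
    have : Real.exp (Real.log q * n / k) ≤ 1 := by
      rw [Real.exp_le_one_iff]
      exact div_nonpos_of_nonpos_of_nonneg (mul_nonpos_of_nonpos_of_nonneg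
        (Real.log_nonpos hq0.le hq1.le) (by linarith)) hkR.le
    nlinarith
  have hfew : ∀ e : Fin n × Fin n ≃ Fin n × Fin n,
      pr q (fun E => ∃ φ : Fin n → Option (Fin k), γ ≤ (univ.filter fun x : Fin n =>
      ((univ.filter fun i : Fin k => ∀ y, φ y = some i → e (x, y) ∉ E).card : ℝ) < β / 2).card) ≤
        Real.exp (-L) := by
    intro e
    refine (pr_few_available e hk hq0 hq1.le β hβ0 hβ.le γ).trans ?_
    have : ((k : ℝ) + 1) ^ n * 2 ^ n = Real.exp (n * (Real.log (k + 1) + Real.log 2)) := by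
      rw [mul_add, Real.exp_add, Real.exp_nat_mul, Real.exp_nat_mul, Real.exp_log (by positivity),
        Real.exp_log (by norm_num)]
    rw [this, ← Real.exp_add, Real.exp_le_exp]
    have h1 : n * (Real.log (k + 1) + Real.log 2) ≤ n * L := by gcongr
    nlinarith
  have hdense := pr_dense_subset hn hq0.le hq1 (hLdef ▸ hL)
  rw [← hLdef] at hdense
  set j := Nat.log 2 (γ + 1) with hj
  have hj1 : 2 ^ j ≤ γ + 1 := Nat.pow_log_le_self 2 (Nat.succ_ne_zero γ)
  have hj2 : γ + 1 < 2 ^ (j + 1) := Nat.lt_pow_succ_log_self (by norm_num) _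
  -- a set of `16 * 2 ^ i` vertices spans at most `g i / 16` times as many edges
  let g : ℕ → ℕ := fun i => ⌈16 * (2 * (16 * 2 ^ i * (1 - q) + L))⌉₊
  have hgsum : 17 + ∑ i ∈ range (j + 1), g i ≤ ⌈β / 2⌉₊ := by
    have h1 : ((17 + ∑ i ∈ range (j + 1), g i : ℕ) : ℝ) ≤ β / 2 := by
      push_cast
      have h2 : ∀ i ∈ range (j + 1), (g i : ℝ) ≤ 512 * (1 - q) * 2 ^ i + (32 * L + 1) := by
        intro i _
        have := (Nat.ceil_lt_add_one (show 0 ≤ 16 * (2 * (16 * 2 ^ i * (1 - q) + L)) by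
          positivity)).le
        refine this.trans (le_of_eq (by ring))
      have h3 := Finset.sum_le_sum h2
      rw [Finset.sum_add_distrib, ← Finset.mul_sum, Finset.sum_const, card_range, nsmul_eq_mul] at h3
      have h4 : 512 * (1 - q) * ∑ i ∈ range (j + 1), (2 : ℝ) ^ i ≤
          512 * (1 - q) * (2 * (γ + 1)) := by
        have h5 : (2 : ℝ) ^ j ≤ γ + 1 := by exact_mod_cast hj1
        have h6 := sum_range_two_pow_le j
        gcongr
        linarith
      have h7 : ((j + 1 : ℕ) : ℝ) ≤ 2 * Real.log n + 1 := by
        have h8 : (2 : ℝ) ^ j ≤ n := by exact_mod_cast hj1.trans hγn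
        have h9 := Real.log_le_log (by positivity) h8
        rw [Real.log_pow] at h9
        have h10 := Real.log_two_gt_d9
        push_cast
        nlinarith [Nat.cast_nonneg (α := ℝ) j]
      have h11 : ((j + 1 : ℕ) : ℝ) * (32 * L + 1) ≤ (2 * Real.log n + 1) * (32 * L + 1) := by
        gcongr
      linarith
    exact_mod_cast h1.trans (Nat.le_ceil _)
  have hwin : ∀ E : Finset (Fin n × Fin n),
      (¬ ∃ φ : Fin n → Option (Fin k), γ ≤ (univ.filter fun x : Fin n =>
        ((univ.filter fun i : Fin k => ∀ y, φ y = some i →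
          Equiv.refl (Fin n × Fin n) (x, y) ∉ E).card : ℝ) < β / 2).card) →
      (¬ ∃ φ : Fin n → Option (Fin k), γ ≤ (univ.filter fun x : Fin n =>
        ((univ.filter fun i : Fin k => ∀ y, φ y = some i →
          Equiv.prodComm (Fin n) (Fin n) (x, y) ∉ E).card : ℝ) < β / 2).card) →
      (¬ ∃ S : Finset (Fin n ⊕ Fin n), 2 * (S.card * (1 - q) + L) * S.card <
        (((S.toLeft ×ˢ S.toRight).filter fun e => e ∈ E).card : ℝ)) →
      gameChromaticNumber (bipartiteGraph (E : Set (Fin n × Fin n))) ≤ k := by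
    intro E h1 h2 h3
    push Not at h1 h2 h3
    refine Nat.sInf_le ⟨hk, makerWins_of_sparse _ ⌈β / 2⌉₊ (2 * γ) j g (fun c => ?_) ?_ ?_ hgsum ?_⟩
    · exact card_few_available_le E c (h1 fun y => c (.inr y)) (h2 fun x => c (.inl x))
    · intro i S hS
      have hS' : (S.card : ℝ) ≤ 16 * 2 ^ i := by exact_mod_cast hS
      refine card_large_inner_degree_le E S (D := 2 * (16 * 2 ^ i * (1 - q) + L)) (by positivity)
        ((h3 S).trans ?_) (Nat.le_ceil _)
      gcongr
    · rw [Nat.ceil_le]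
      linarith
    · rw [pow_succ] at hj2
      omega
  refine (pr_or_le hq0.le hq1.le (fun E hE => ?_)).trans ((add_le_add (hfew (Equiv.refl _))
    ((pr_or_le hq0.le hq1.le fun E hE => hE).trans (add_le_add (hfew (Equiv.prodComm _ _))
      hdense))).trans (le_of_eq (by ring)))
  by_contra hcon
  rw [not_or, not_or] at hcon
  exact hE (hwin E hcon.1 hcon.2.1 hcon.2.2)

end RandomBipartite

namespace RandomBipartite

open Finset ColoringGame

theorem eventually_mul_pow_le_exp (C : ℝ) {b : ℝ} (hb : 0 < b) (m : ℕ) :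
    ∀ᶠ x : ℝ in atTop, C * x ^ m ≤ Real.exp (b * x) := by
  have h := (isLittleO_pow_exp_pos_mul_atTop m hb).bound (show (0 : ℝ) < 1 / (|C| + 1) by positivity)
  filter_upwards [h, eventually_ge_atTop 0] with x hx hx0
  rw [Real.norm_of_nonneg (by positivity), Real.norm_of_nonneg (Real.exp_pos _).le, one_div,
    inv_mul_eq_div, le_div_iff₀ (by positivity)] at hx
  have h1 : C ≤ |C| + 1 := (le_abs_self C).trans (by linarith)
  have h2 : 0 ≤ x ^ m := by positivity
  nlinarith

theorem logbnp_eq (n : ℕ) (p : unitInterval) :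
    logbnp n p = Real.log (n * p) / -Real.log (1 - p) := by
  rw [logbnp, Real.logb, one_div, Real.log_inv]

theorem le_neg_log_one_sub {p : ℝ} (hp : p < 1) : p ≤ -Real.log (1 - p) := by
  have := Real.log_le_sub_one_of_pos (show 0 < 1 - p by linarith)
  linarith

theorem neg_log_one_sub_le {p η : ℝ} (hη : 0 < η) (hp0 : 0 ≤ p) (hp : p ≤ 1 - η) :
    -Real.log (1 - p) ≤ p / η := by
  have hq : 0 < 1 - p := by linarith
  have h1 := Real.log_le_sub_one_of_pos (inv_pos.2 hq)
  rw [Real.log_inv] at h1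
  have h2 : (1 - p)⁻¹ - 1 = p / (1 - p) := by field_simp; ring
  have h3 : p / (1 - p) ≤ p / η := by gcongr; linarith
  linarith

set_option maxHeartbeats 400000 in
/-- The upper bound for fixed `n`, when `L = log (n * p)` exceeds a constant depending on `α` and `η`.
Each of the `α * n / log_b (n * p)` colors is used on about `log_b (n * p) / α` vertices, so that it
remains available at a vertex with probability about `(n * p) ^ (-1 / α)`, and the expected number `β`
of available colors is about `(n * p) ^ (1 - 1 / α)`. The hypotheses `h5` and `h6` make `β` exceed
`L * log n`, and `h4` makes `β ^ 2` exceed `n * p * L`. -/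
theorem pr_gameChromaticNumber_gt_le_of_large {n : ℕ} {p : unitInterval} {η α L : ℝ} (hη : 0 < η)
    (hα : 2 < α) (hp0 : 0 < (p : ℝ)) (hpη : (p : ℝ) ≤ 1 - η) (hn : 0 < n)
    (hLdef : L = Real.log (n * p)) (h1 : 2065 ≤ L) (h2 : 4 * α / η ≤ L)
    (h3 : L ^ 2 ≤ Real.exp L) (h4 : 2 ^ 18 * L ^ 3 ≤ Real.exp ((1 - 2 / α) * L))
    (h5 : 800 * L ^ 2 ≤ Real.exp ((1 - 1 / α) / 2 * L))
    (h6 : Real.log n ≤ Real.exp ((1 - 1 / α) / 2 * L)) :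
    pr (1 - (p : ℝ)) (fun E : Finset (Fin n × Fin n) =>
      ¬ (gameChromaticNumber (bipartiteGraph (E : Set (Fin n × Fin n))) : ℝ) ≤
        α * ((n : ℝ) / logbnp n p)) ≤ 4 * Real.exp (-L) := by
  have hnR : (1 : ℝ) ≤ n := by exact_mod_cast hn
  set q := 1 - (p : ℝ) with hq
  have hq0 : 0 < q := by linarith
  have hq1 : q < 1 := by linarith
  have hp : (p : ℝ) = 1 - q := by rw [hq]; ring
  set ℓ := -Real.log q with hℓ
  have hℓ1 : (p : ℝ) ≤ ℓ := le_neg_log_one_sub (by linarith)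
  have hℓ2 : ℓ ≤ p / η := neg_log_one_sub_le hη hp0.le hpη
  have hL0 : 0 < L := by linarith
  have hα0 : 0 < α := by linarith
  set P := (n : ℝ) * p with hP
  have hP0 : 0 < P := by positivity
  have hPL : Real.exp L = P := by rw [hLdef, Real.exp_log hP0]
  rw [hPL] at h3
  have hP1 : 4 ≤ P := by nlinarith
  have hlogn : L ≤ Real.log n := by
    rw [hLdef]
    refine Real.log_le_log hP0 ?_
    have : (p : ℝ) ≤ 1 := p.2.2
    nlinarith
  set κ := α * (n / logbnp n p) with hκ
  have hκ' : κ = α * n * ℓ / L := by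
    rw [hκ, logbnp_eq, ← hP, ← hLdef, ← hq, ← hℓ]
    have : ℓ ≠ 0 := by linarith
    field_simp
  have hκ1 : 2 * (P / L) ≤ κ := by
    have : α * n * ℓ / L = α * (n * ℓ / L) := by ring
    rw [hκ', this]
    have : P / L ≤ n * ℓ / L := by rw [hP]; gcongr
    have : 0 ≤ P / L := by positivity
    nlinarith
  have hκ2 : κ ≤ P / 4 := by
    rw [hκ', div_le_iff₀ hL0]
    have e1 : α * n * ℓ ≤ α * n * (p / η) := by gcongr
    have e2 : α * n * (p / η) = (4 * α / η) * (P / 4) := by rw [hP]; ring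
    have e3 : (4 * α / η) * (P / 4) ≤ L * (P / 4) := by gcongr
    linarith
  have hPL1 : L ≤ P / L := by
    rw [le_div_iff₀ hL0]
    nlinarith
  have hκ0 : 0 ≤ κ := by linarith
  set k := ⌊κ⌋₊ with hk
  have hk1 : (k : ℝ) ≤ κ := Nat.floor_le hκ0
  have hk2 : κ < k + 1 := Nat.lt_floor_add_one κ
  have hk3 : P / L ≤ k := by linarith
  have hkR : 0 < (k : ℝ) := by linarith
  have hkpos : 0 < k := by exact_mod_cast hkR
  set β := k * Real.exp (Real.log q * n / k) with hβ
  have hexp : -(L / α) - 1 / 2 ≤ Real.log q * n / k := by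
    rw [le_div_iff₀ hkR]
    have e1 : α * (n * ℓ) ≤ (k + 1) * L := by
      have : α * n * ℓ = κ * L := by rw [hκ']; field_simp
      have := mul_le_mul_of_nonneg_right hk2.le hL0.le
      linarith
    have e2 : n * ℓ ≤ (k + 1) * (L / α) := by
      rw [mul_div_assoc', le_div_iff₀ hα0]
      linarith
    have e3 : L / α ≤ k / 2 := by
      rw [div_le_iff₀ hα0]
      have := mul_le_mul_of_nonneg_left hα.le hkR.le
      linarith
    have e4 : Real.log q * n = -(n * ℓ) := by rw [hℓ]; ring
    have e5 : (-(L / α) - 1 / 2) * k = -((k + 1) * (L / α)) + L / α - k / 2 := by ring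
    rw [e4, e5]
    linarith
  have hβ1 : Real.exp ((1 - 1 / α) * L) / (2 * L) ≤ β := by
    have e1 : Real.exp (-(L / α)) / 2 ≤ Real.exp (Real.log q * n / k) := by
      refine le_trans ?_ (Real.exp_le_exp.2 hexp)
      rw [sub_eq_add_neg, Real.exp_add, div_eq_mul_inv]
      gcongr
      linarith [Real.add_one_le_exp (-(1 / 2 : ℝ))]
    have e2 : Real.exp ((1 - 1 / α) * L) / (2 * L) = P / L * (Real.exp (-(L / α)) / 2) := by
      rw [← hPL, show (1 - 1 / α) * L = L + -(L / α) by ring, Real.exp_add]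
      field_simp
    rw [e2, hβ]
    gcongr
  have hβ0 : 0 < β := by positivity
  have hβ2 : 400 * (L * Real.log n) ≤ β := by
    refine le_trans ?_ hβ1
    rw [le_div_iff₀ (by positivity), show (1 - 1 / α) * L =
      (1 - 1 / α) / 2 * L + (1 - 1 / α) / 2 * L by ring, Real.exp_add]
    have := mul_le_mul h5 h6 (by linarith) (Real.exp_pos _).le
    linarith
  have hβ3 : 65536 * (P * L) ≤ β * β := by
    have e1 : 65536 * (P * L) ≤
        Real.exp ((1 - 1 / α) * L) / (2 * L) * (Real.exp ((1 - 1 / α) * L) / (2 * L)) := by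
      rw [div_mul_div_comm, le_div_iff₀ (by positivity), ← Real.exp_add,
        show (1 - 1 / α) * L + (1 - 1 / α) * L = L + (1 - 2 / α) * L by ring, Real.exp_add, hPL]
      have := mul_le_mul_of_nonneg_left h4 hP0.le
      linarith
    refine e1.trans ?_
    gcongr
  -- the number of vertices for which the tail bound beats the number of colorings
  set γ := ⌈16 * n * L / β⌉₊ with hγ
  have hγ1 : 16 * n * L / β ≤ γ := Nat.le_ceil _
  have hγ2 : (γ : ℝ) ≤ 16 * n * L / β + 1 := (Nat.ceil_lt_add_one (by positivity)).le
  have hLlog : L ≤ L * Real.log n := le_mul_of_one_le_right hL0.le (by linarith)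
  have hmain := pr_gameChromaticNumber_gt_le (n := n) (k := k) (q := q) (L := L) (β := β) (γ := γ)
    hn hkpos hq0 hq1 (by rw [hLdef, hP, hp]) (by linarith) hβ ?_ ?_ ?_ ?_
  · refine (pr_mono hq0.le hq1.le fun E hE hle => hE ?_).trans hmain
    exact le_trans (by exact_mod_cast hle) hk1
  · have e1 : 16 * n * L / β ≤ n / 25 := by
      rw [div_le_iff₀ hβ0]
      have := mul_le_mul_of_nonneg_left (show 400 * L ≤ β by linarith) (show 0 ≤ (n : ℝ) by linarith)
      linarith
    have e2 : (3 : ℝ) ≤ n := by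
      have := Real.log_le_sub_one_of_pos (show (0 : ℝ) < n by linarith)
      linarith
    have : (γ : ℝ) + 1 ≤ n := by linarith
    exact_mod_cast this
  · rw [← Real.log_mul (by linarith) (by norm_num), hLdef]
    exact Real.log_le_log (by linarith) (by linarith)
  · rw [div_le_iff₀ hβ0] at hγ1
    linarith
  · rw [← hp]
    have e1 : ((γ : ℝ) + 1) * p ≤ 16 * (P * L) / β + 2 := by
      have : ((γ : ℝ) + 1) * p ≤ (16 * n * L / β + 2) * p :=
        mul_le_mul_of_nonneg_right (by linarith) hp0.le
      have e : (16 * n * L / β + 2) * (p : ℝ) = 16 * (P * L) / β + 2 * p := by rw [hP]; ring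
      have : (p : ℝ) ≤ 1 := p.2.2
      linarith
    have e2 : 16 * (P * L) / β ≤ β / 4096 := by
      rw [div_le_iff₀ hβ0]
      linarith
    have e3 : (32 * L + 1) * (2 * Real.log n + 1) ≤ 33 * L * (3 * Real.log n) := by
      gcongr <;> linarith
    linarith

/-- With `α * n / log_b (n * p)` colors Maker wins with high probability. -/
theorem whp_gameChromaticNumber_le {η α K : ℝ} (hη : 0 < η) (hα : 2 < α)
    (hK : K = max (2 * α / (α - 1)) (α / (α - 2))) (p : ℕ → unitInterval)
    (hp : ∀ᶠ n : ℕ in atTop, Real.log n ^ K / (n : ℝ) ≤ (p n : ℝ) ∧ (p n : ℝ) ≤ 1 - η) :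
    Whp p (fun n G => (gameChromaticNumber G : ℝ) ≤ α * ((n : ℝ) / logbnp n (p n))) := by
  refine whp_of_pr_not_le p _ fun ε hε => ?_
  have hα0 : 0 < α := by linarith
  have hα1 : 0 < α - 1 := by linarith
  have hK2 : 2 * α / (α - 1) ≤ K := hK ▸ le_max_left _ _
  have hK0 : 0 < K := lt_of_lt_of_le (by positivity) hK2
  have hb1 : 0 < 1 - 2 / α := by rw [sub_pos, div_lt_one hα0]; exact hα
  have hb2 : 0 < (1 - 1 / α) / 2 := by
    have : 1 / α < 1 := by rw [div_lt_one hα0]; linarith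
    linarith
  have hKb : 1 ≤ K * ((1 - 1 / α) / 2) := by
    have : 2 * α / (α - 1) * ((1 - 1 / α) / 2) = 1 := by field_simp
    calc (1 : ℝ) = _ := this.symm
      _ ≤ _ := by gcongr
  have hlarge : ∀ᶠ L : ℝ in atTop, 2065 ≤ L ∧ 4 * α / η ≤ L ∧ L ^ 2 ≤ Real.exp L ∧
      2 ^ 18 * L ^ 3 ≤ Real.exp ((1 - 2 / α) * L) ∧
      800 * L ^ 2 ≤ Real.exp ((1 - 1 / α) / 2 * L) ∧ 4 * Real.exp (-L) ≤ ε := by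
    filter_upwards [eventually_ge_atTop 2065, eventually_ge_atTop (4 * α / η),
      eventually_mul_pow_le_exp 1 one_pos 2, eventually_mul_pow_le_exp (2 ^ 18) hb1 3,
      eventually_mul_pow_le_exp 800 hb2 2, eventually_mul_pow_le_exp (4 / ε) one_pos 0]
      with L l1 l2 l3 l4 l5 l6
    refine ⟨l1, l2, by simpa using l3, l4, l5, ?_⟩
    rw [pow_zero, mul_one, one_mul, div_le_iff₀ hε] at l6
    rw [Real.exp_neg, ← div_eq_mul_inv, div_le_iff₀ (Real.exp_pos _)]
    linarith
  obtain ⟨M, hM⟩ := eventually_atTop.1 hlarge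
  have hlog : Tendsto (fun n : ℕ => Real.log n) atTop atTop :=
    Real.tendsto_log_atTop.comp tendsto_natCast_atTop_atTop
  have hloglog : Tendsto (fun n : ℕ => K * Real.log (Real.log n)) atTop atTop :=
    (Real.tendsto_log_atTop.comp hlog).const_mul_atTop hK0
  filter_upwards [hp, hloglog.eventually_ge_atTop M, hlog.eventually_ge_atTop 1,
    eventually_gt_atTop 0] with n hpn hnM hn1 hn0
  have hnR : (0 : ℝ) < n := by exact_mod_cast hn0
  have hlogpow : 0 < Real.log n ^ K := Real.rpow_pos_of_pos (by linarith) _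
  have hp0 : 0 < (p n : ℝ) := lt_of_lt_of_le (by positivity) hpn.1
  have hP : Real.log n ^ K ≤ n * p n := by
    have := hpn.1
    rw [div_le_iff₀ hnR] at this
    linarith
  have hL : K * Real.log (Real.log n) ≤ Real.log (n * p n) := by
    rw [← Real.log_rpow (by linarith)]
    exact Real.log_le_log hlogpow hP
  obtain ⟨l1, l2, l3, l4, l5, l6⟩ := hM _ (hnM.trans hL)
  refine (pr_gameChromaticNumber_gt_le_of_large hη hα hp0 hpn.2 hn0 rfl l1 l2 l3 l4 l5 ?_).trans l6
  rw [← Real.log_le_iff_le_exp (by linarith)]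
  have hll : 0 ≤ Real.log (Real.log n) := Real.log_nonneg hn1
  calc Real.log (Real.log n) = 1 * Real.log (Real.log n) := (one_mul _).symm
    _ ≤ K * ((1 - 1 / α) / 2) * Real.log (Real.log n) := by gcongr
    _ = (1 - 1 / α) / 2 * (K * Real.log (Real.log n)) := by ring
    _ ≤ _ := by gcongr

end RandomBipartite

/-! ### Random bipartite graphs are pseudorandom -/

namespace RandomBipartite

open Finset ColoringGame

variable {n k t x : ℕ} {q δ : ℝ}

/-- The union bound over all nonempty subsets of a set with `N` elements, when a set `S` is bad
with probability at most `b ^ |S|` and `N * b ≤ 1 / 2`. -/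
theorem pr_exists_nonempty_le {ι κ : Type*} [Fintype ι] [DecidableEq ι] [Fintype κ]
    [DecidableEq κ] (hq0 : 0 ≤ q) (hq1 : q ≤ 1) (Q : Finset κ → Finset ι → Prop) {b : ℝ}
    (hb0 : 0 ≤ b) (hb : Fintype.card κ * b ≤ 1 / 2) (h : ∀ S, S.Nonempty → pr q (Q S) ≤ b ^ S.card) :
    pr q (fun E => ∃ S, S.Nonempty ∧ Q S E) ≤ 2 * (Fintype.card κ * b) := by
  classical
  refine (pr_le_sum hq0 hq1 ((univ : Finset κ).powerset.filter fun S => S.Nonempty) Q ?_).trans ?_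
  · rintro E ⟨S, hS, hQ⟩
    exact ⟨S, by simpa using hS, hQ⟩
  refine (Finset.sum_le_sum fun S hS => h S (mem_filter.1 hS).2).trans ?_
  rw [Finset.sum_filter]
  simp only [← Finset.card_pos]
  have h1 := Finset.sum_powerset_apply_card (x := (univ : Finset κ))
    (fun s : ℕ => if 0 < s then b ^ s else 0)
  rw [h1, Finset.sum_range_succ']
  simp only [lt_self_iff_false, if_false, smul_zero, add_zero, Nat.succ_pos, if_true]
  refine le_trans (Finset.sum_le_sum fun s _ => ?_)
    (sum_range_succ_pow_le (by positivity) hb (univ : Finset κ).card)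
  rw [nsmul_eq_mul, mul_pow, Finset.card_univ]
  gcongr
  exact_mod_cast Nat.choose_le_pow _ _

theorem card_filter_card_le (n x : ℕ) :
    ((univ : Finset (Finset (Fin n))).filter fun X => X.card ≤ x).card ≤ (n + 1) ^ x := by
  have h1 := Finset.sum_powerset_apply_card (x := (univ : Finset (Fin n)))
    (fun s : ℕ => if s ≤ x then 1 else 0)
  rw [Finset.powerset_univ, ← Finset.card_filter] at h1
  rw [h1, add_pow, ← Finset.sum_filter_add_sum_filter_not (range _) (· ≤ x)]
  have h2 : ∑ s ∈ (range ((univ : Finset (Fin n)).card + 1)).filter (fun s => ¬ s ≤ x),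
      (univ : Finset (Fin n)).card.choose s • (if s ≤ x then 1 else 0) = 0 :=
    Finset.sum_eq_zero fun s hs => by simp [(mem_filter.1 hs).2]
  rw [h2, add_zero]
  refine (Finset.sum_le_sum fun s hs => ?_).trans
    (Finset.sum_le_sum_of_subset (s := (range _).filter (· ≤ x)) ?_)
  · have hs' := (mem_filter.1 hs).2
    have h3 := Nat.choose_pos hs'
    simp only [hs', if_true, smul_eq_mul, mul_one, one_pow, card_univ, Fintype.card_fin]
    exact (Nat.choose_le_pow n s).trans (Nat.le_mul_of_pos_right _ (by simpa using h3))
  · intro s hs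
    have := (mem_filter.1 hs).2
    simp only [mem_range]
    omega

theorem freeL_eq_filter (E : Finset (Fin n × Fin n)) (S : Finset (Fin n)) :
    freeL E S = univ.filter fun v => Disjoint E (block (Equiv.refl _) v S) := by
  ext v
  simp [freeL, disjoint_block_iff]

theorem freeR_eq_filter (E : Finset (Fin n × Fin n)) (S : Finset (Fin n)) :
    freeR E S = univ.filter fun v => Disjoint E (block (Equiv.prodComm _ _) v S) := by
  ext v
  simp [freeR, disjoint_block_iff]

theorem exp_neg_log_pow {n : ℕ} (hn : 0 < n) (m s : ℕ) :
    ((1 / (n : ℝ)) ^ m) ^ s = Real.exp (-(m * s * Real.log n)) := by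
  have : (0 : ℝ) < n := by exact_mod_cast hn
  rw [← pow_mul, one_div, inv_pow, ← Real.exp_log this, ← Real.exp_nat_mul, ← Real.exp_neg,
    Real.log_exp]
  push_cast
  ring_nf

/-- A common bound for the union over all nonempty sets of at most `t` vertices. -/
theorem pr_exists_small_le (hn : 2 ≤ n) (hq0 : 0 < q) (hq1 : q ≤ 1)
    (ht : 100 * (t * Real.log n) ≤ n * q ^ t) (Q : Finset (Fin n) → Finset (Fin n × Fin n) → Prop)
    (hQ : ∀ S, S.card ≤ t → pr q (Q S) ≤ Real.exp (-(n * q ^ S.card / 8))) :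
    pr q (fun E => ∃ S, S.Nonempty ∧ (S.card ≤ t ∧ Q S E)) ≤ 2 / n ^ 2 := by
  have hnR : (2 : ℝ) ≤ n := by exact_mod_cast hn
  have hlog : 0 ≤ Real.log n := Real.log_nonneg (by linarith)
  have hb : ((Fintype.card (Fin n) : ℕ) : ℝ) * (1 / (n : ℝ)) ^ 3 = 1 / n ^ 2 := by
    rw [Fintype.card_fin]
    field_simp
  refine (pr_exists_nonempty_le hq0.le hq1 (fun S E => S.card ≤ t ∧ Q S E)
    (b := (1 / (n : ℝ)) ^ 3) (by positivity) ?_ ?_).trans (le_of_eq ?_)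
  · rw [hb, div_le_div_iff₀ (by positivity) (by norm_num)]
    nlinarith
  · intro S _
    by_cases hS : S.card ≤ t
    · refine (pr_mono hq0.le hq1 fun E hE => hE.2).trans ((hQ S hS).trans ?_)
      rw [exp_neg_log_pow (by omega), Real.exp_le_exp, neg_le_neg_iff]
      have h1 := pow_le_pow_of_le_one hq0.le hq1 hS
      have h2 : (n : ℝ) * q ^ t ≤ n * q ^ S.card := by gcongr
      have h3 : (S.card : ℝ) * Real.log n ≤ t * Real.log n := by gcongr
      have h4 : 0 ≤ (S.card : ℝ) * Real.log n := by positivity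
      push_cast
      linarith
    · refine le_trans (le_of_eq ?_) (by positivity : (0 : ℝ) ≤ _)
      simp [pr, expect, hS]
  · rw [hb]
    ring

theorem pr_not_upper_le (hn : 2 ≤ n) (hq0 : 0 < q) (hq1 : q ≤ 1)
    (ht : 100 * (t * Real.log n) ≤ n * q ^ t) :
    pr q (fun E => ¬ ∀ T : Finset (Fin n), T.card ≤ t →
      ((freeR E T).card : ℝ) ≤ 2 * (n * q ^ T.card)) ≤ 2 / n ^ 2 := by
  refine (pr_mono hq0.le hq1 ?_).trans (pr_exists_small_le hn hq0 hq1 ht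
    (fun T E => 2 * (n * q ^ T.card) < ((freeR E T).card : ℝ)) fun T _ => ?_)
  · intro E hE
    push Not at hE
    obtain ⟨T, hT, hT'⟩ := hE
    refine ⟨T, Finset.nonempty_iff_ne_empty.2 ?_, hT, hT'⟩
    rintro rfl
    have : ((freeR E (∅ : Finset (Fin n))).card : ℝ) ≤ n := by
      exact_mod_cast (Finset.card_le_univ _).trans (by simp)
    simp only [card_empty, pow_zero, mul_one] at hT'
    have : (0 : ℝ) ≤ n := Nat.cast_nonneg n
    linarith
  · have h := pr_avoided_le hq0.le hq1 (univ : Finset (Fin n))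
      (fun v => block (Equiv.prodComm _ _) v T)
      (fun v _ w _ hvw => disjoint_block_block _ (Or.inl hvw)) 1 (2 * (n * q ^ T.card))
    refine (pr_mono hq0.le hq1 fun E hE => ?_).trans (h.trans ?_)
    · rw [freeR_eq_filter] at hE
      linarith
    · rw [Real.exp_le_exp]
      simp only [card_block, sum_const, card_univ, Fintype.card_fin, nsmul_eq_mul]
      have : 0 ≤ (n : ℝ) * q ^ T.card := by positivity
      have := Real.exp_one_lt_d9
      nlinarith

theorem pr_not_lower_le (hn : 2 ≤ n) (hq0 : 0 < q) (hq1 : q ≤ 1)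
    (ht : 100 * (t * Real.log n) ≤ n * q ^ t) :
    pr q (fun E => ¬ ∀ S : Finset (Fin n), S.card ≤ t →
      (n * q ^ S.card) / 2 ≤ ((freeL E S).card : ℝ)) ≤ 2 / n ^ 2 := by
  refine (pr_mono hq0.le hq1 ?_).trans (pr_exists_small_le hn hq0 hq1 ht
    (fun S E => ((freeL E S).card : ℝ) < (n * q ^ S.card) / 2) fun S _ => ?_)
  · intro E hE
    push Not at hE
    obtain ⟨T, hT, hT'⟩ := hE
    refine ⟨T, Finset.nonempty_iff_ne_empty.2 ?_, hT, hT'⟩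
    rintro rfl
    have : (freeL E (∅ : Finset (Fin n))).card = n := by simp [freeL]
    rw [this] at hT'
    simp only [card_empty, pow_zero, mul_one] at hT'
    have : (0 : ℝ) ≤ n := Nat.cast_nonneg n
    linarith
  · have h := pr_avoided_le hq0.le hq1 (univ : Finset (Fin n))
      (fun v => block (Equiv.refl _) v S)
      (fun v _ w _ hvw => disjoint_block_block _ (Or.inl hvw)) (-1) (n * q ^ S.card / 2)
    refine (pr_mono hq0.le hq1 fun E hE => ?_).trans (h.trans ?_)
    · rw [freeL_eq_filter] at hE
      linarith
    · rw [Real.exp_le_exp]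
      simp only [card_block, sum_const, card_univ, Fintype.card_fin, nsmul_eq_mul]
      have h1 : 0 ≤ (n : ℝ) * q ^ S.card := by positivity
      have h2 : Real.exp (-1) ≤ 3 / 8 := by
        have := Real.exp_one_gt_d9
        rw [Real.exp_neg, inv_le_comm₀ (Real.exp_pos _) (by norm_num)]
        linarith
      nlinarith

/-- The discrepancy allowed in `Pseudorandom.disc`. It is of the order of the standard deviation
times the square root of the entropy of the choice of the two sets, and so small that the losses of
potential form a geometric series. -/
noncomputable def discBound (n : ℕ) (q : ℝ) (r : ℕ) : ℝ :=
  √(256 / q * (1 - q) * n * Real.log n * q ^ r)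

theorem exp_neg_le_quadratic {a : ℝ} (ha : 0 ≤ a) : Real.exp (-a) ≤ 1 - a + a ^ 2 / 2 := by
  have h1 := Real.quadratic_le_exp_of_nonneg ha
  have h2 : 0 < 1 + a + a ^ 2 / 2 := by positivity
  rw [Real.exp_neg]
  refine (inv_anti₀ h2 h1).trans ?_
  rw [inv_le_iff_one_le_mul₀ h2]
  nlinarith [sq_nonneg (a ^ 2)]

theorem pr_disc_pair_le (hn : 2 ≤ n) (hq0 : 0 < q) (hq1 : q < 1) (r : ℕ) (A B : Finset (Fin n))
    (hA : A.card = ⌈n * q ^ (r + 1) / 4⌉₊) (hB : (B.card : ℝ) ≤ 2 * (n * q ^ r)) :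
    pr q (fun E => (((A ×ˢ B).filter fun e => e ∈ E).card : ℝ) <
      (1 - q) * (A.card * B.card) - discBound n q r * A.card) ≤
      ((1 / (n : ℝ)) ^ 4) ^ (A.card + B.card) := by
  have hnR : (2 : ℝ) ≤ n := by exact_mod_cast hn
  have hlog : 0 < Real.log n := Real.log_pos (by linarith)
  have hp : 0 < 1 - q := by linarith
  set d := discBound n q r with hd
  have hd0 : 0 ≤ d := Real.sqrt_nonneg _
  have hd2 : d ^ 2 = 256 / q * (1 - q) * n * Real.log n * q ^ r := by
    rw [hd, discBound, Real.sq_sqrt (by positivity)]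
  set m := (n : ℝ) * q ^ r with hm
  have hm0 : 0 < m := by positivity
  -- the optimal parameter for the quadratic upper bound of `Real.exp (-a)`
  set a := d / (2 * (1 - q) * m) with ha
  have ha0 : 0 ≤ a := by positivity
  refine (pr_mono hq0.le hq1.le fun E hE => ?_).trans ((pr_card_inter_le hq0.le hq1.le (A ×ˢ B) (-a)
    ((1 - q) * (A.card * B.card) - d * A.card)).trans ?_)
  · rw [neg_mul, ← mul_neg]
    exact mul_nonneg ha0 (by linarith)
  · rw [exp_neg_log_pow (by omega), Real.exp_le_exp, Finset.card_product]
    push_cast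
    have hA1 : m * q / 4 ≤ A.card := by
      rw [hA]
      refine le_trans (le_of_eq ?_) (Nat.le_ceil _)
      rw [hm, pow_succ]
      ring
    have h1 := exp_neg_le_quadratic ha0
    have h2 : (Real.exp (-a) - 1) * (1 - q) * (A.card * B.card) ≤
        (-a + a ^ 2 / 2) * (1 - q) * (A.card * B.card) := by
      gcongr
      linarith
    have h3 : a ^ 2 / 2 * (1 - q) * (A.card * B.card) ≤
        a ^ 2 / 2 * (1 - q) * (A.card * (2 * m)) := by
      gcongr
    have h4 : a ^ 2 / 2 * (1 - q) * (A.card * (2 * m)) = a * d * A.card / 2 := by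
      rw [ha]
      field_simp
    have h5 : a * d = 128 / q * Real.log n := by
      have : a * d = d ^ 2 / (2 * (1 - q) * m) := by rw [ha]; ring
      rw [this, hd2, hm]
      field_simp
      norm_num
    have h6 : 4 * ((A.card : ℝ) + B.card) ≤ 64 / q * A.card := by
      have e1 : (A.card : ℝ) ≤ A.card / q := by
        rw [le_div_iff₀ hq0]
        nlinarith [Nat.cast_nonneg (α := ℝ) A.card]
      have e2 : m ≤ 4 * (A.card / q) := by
        rw [mul_div_assoc', le_div_iff₀ hq0]
        linarith
      have e3 : 64 / q * A.card = 64 * (A.card / q) := by ring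
      have e4 : (0 : ℝ) ≤ A.card / q := by positivity
      rw [e3]
      linarith
    have h7 : a * d * A.card / 2 = 64 / q * A.card * Real.log n := by rw [h5]; ring
    have h8 : 4 * ((A.card : ℝ) + B.card) * Real.log n ≤ 64 / q * A.card * Real.log n := by gcongr
    nlinarith

theorem pr_not_disc_le (hn : 2 ≤ n) (hq0 : 0 < q) (hq1 : q < 1) (htn : t ≤ n) :
    pr q (fun E => ¬ ∀ r < t, ∀ A B : Finset (Fin n), A.card = ⌈n * q ^ (r + 1) / 4⌉₊ →
      (B.card : ℝ) ≤ 2 * (n * q ^ r) → (1 - q) * (A.card * B.card) - discBound n q r * A.card ≤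
        (((A ×ˢ B).filter fun e => e ∈ E).card : ℝ)) ≤ 4 / n ^ 2 := by
  have hnR : (2 : ℝ) ≤ n := by exact_mod_cast hn
  have hbad : ∀ r ∈ range t, pr q (fun E => ∃ S : Finset (Fin n ⊕ Fin n), S.Nonempty ∧
      (S.toLeft.card = ⌈n * q ^ (r + 1) / 4⌉₊ ∧ (S.toRight.card : ℝ) ≤ 2 * (n * q ^ r) ∧
      (((S.toLeft ×ˢ S.toRight).filter fun e => e ∈ E).card : ℝ) <
        (1 - q) * (S.toLeft.card * S.toRight.card) - discBound n q r * S.toLeft.card)) ≤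
        4 / n ^ 3 := by
    intro r _
    have hb : ((Fintype.card (Fin n ⊕ Fin n) : ℕ) : ℝ) * (1 / (n : ℝ)) ^ 4 = 2 / n ^ 3 := by
      rw [Fintype.card_sum, Fintype.card_fin]
      push_cast
      field_simp
      ring
    refine (pr_exists_nonempty_le hq0.le hq1.le (fun (S : Finset (Fin n ⊕ Fin n)) E =>
      S.toLeft.card = ⌈n * q ^ (r + 1) / 4⌉₊ ∧ (S.toRight.card : ℝ) ≤ 2 * (n * q ^ r) ∧
      (((S.toLeft ×ˢ S.toRight).filter fun e => e ∈ E).card : ℝ) <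
        (1 - q) * (S.toLeft.card * S.toRight.card) - discBound n q r * S.toLeft.card)
      (b := (1 / (n : ℝ)) ^ 4) (by positivity) ?_ ?_).trans (le_of_eq ?_)
    · rw [hb, div_le_div_iff₀ (by positivity) (by norm_num)]
      have : (2 : ℝ) ^ 3 ≤ (n : ℝ) ^ 3 := by gcongr
      linarith
    · intro S _
      by_cases hS : S.toLeft.card = ⌈n * q ^ (r + 1) / 4⌉₊ ∧
          (S.toRight.card : ℝ) ≤ 2 * (n * q ^ r)
      · rw [← Finset.card_toLeft_add_card_toRight (u := S)]
        exact (pr_mono hq0.le hq1.le fun E hE => hE.2.2).trans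
          (pr_disc_pair_le hn hq0 hq1 r _ _ hS.1 hS.2)
      · refine le_trans (le_of_eq ?_) (by positivity : (0 : ℝ) ≤ _)
        rw [not_and_or] at hS
        rcases hS with hS | hS <;> simp [pr, expect, hS]
    · rw [hb]
      ring
  refine (pr_le_card_mul hq0.le hq1.le (range t) _ (M := n) ?_ (by simpa using htn)
    (by positivity) hbad).trans (le_of_eq ?_)
  · intro E hE
    push Not at hE
    obtain ⟨r, hr, A, B, hA, hB, h⟩ := hE
    have hAne : A.Nonempty := by
      rw [← Finset.card_pos, hA, Nat.ceil_pos]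
      positivity
    refine ⟨r, mem_range.2 hr, A.disjSum B, ?_, by simpa using hA, by simpa using hB,
      by simpa using h⟩
    obtain ⟨z, hz⟩ := hAne
    exact ⟨.inl z, by simpa using hz⟩
  · field_simp

/-- A small set `X` rarely contains a constant proportion of the common non-neighbors of each of
several disjoint sets. -/
theorem pr_not_block_le (hn : 2 ≤ n) (hq0 : 0 < q) (hq1 : q ≤ 1) (ht : 1 ≤ t) (hδ : 0 < δ)
    (hkx : 2 * (k * t) ≤ x) (hx : 2 * x * Real.log (n + 1) ≤ n)
    (hxδ : x * Real.exp (4 + 8 / δ) ≤ n) :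
    pr q (fun E => ¬ ∀ (X : Finset (Fin n)) (J : Finset (Fin k)) (S : Fin k → Finset (Fin n)),
    X.card ≤ x → (∀ i, (S i).card ≤ t) → (∀ i j, i ≠ j → Disjoint (S i) (S j)) →
    (∀ i ∈ J, (n * q ^ (S i).card) / 4 ≤ ((freeL E (S i) ∩ X).card : ℝ)) →
    ∑ i ∈ J, q ^ (S i).card ≤ δ) ≤ 1 / n ^ 2 := by
  classical
  have hnR : (2 : ℝ) ≤ n := by exact_mod_cast hn
  let index : Finset (Finset (Fin n) × Finset (Fin k) × (Fin k → Finset (Fin n))) :=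
    (univ.filter fun X => X.card ≤ x) ×ˢ (univ ×ˢ Fintype.piFinset fun _ =>
      univ.filter fun S => S.card ≤ t)
  have hcard : (index.card : ℝ) ≤ Real.exp n := by
    have h1 : index.card ≤ (n + 1) ^ (2 * x) := by
      have e1 : (2 : ℕ) ^ k ≤ (n + 1) ^ (t * k) := by
        calc 2 ^ k ≤ (n + 1) ^ k := Nat.pow_le_pow_left (by omega) k
          _ ≤ (n + 1) ^ (t * k) := Nat.pow_le_pow_right (by omega) (Nat.le_mul_of_pos_left k ht)
      have e2 : (∏ _i : Fin k, ((univ : Finset (Finset (Fin n))).filter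
          fun S => S.card ≤ t).card) ≤ (n + 1) ^ (t * k) := by
        rw [Finset.prod_const, card_univ, Fintype.card_fin, pow_mul]
        exact Nat.pow_le_pow_left (card_filter_card_le n t) k
      have e3 : index.card = ((univ : Finset (Finset (Fin n))).filter fun X => X.card ≤ x).card *
          (2 ^ k * ∏ _i : Fin k, ((univ : Finset (Finset (Fin n))).filter
            fun S => S.card ≤ t).card) := by
        simp only [index, Finset.card_product, Fintype.card_piFinset, card_univ,
          Fintype.card_finset, Fintype.card_fin]
      rw [e3]
      calc _ ≤ (n + 1) ^ x * ((n + 1) ^ (t * k) * (n + 1) ^ (t * k)) :=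
            Nat.mul_le_mul (card_filter_card_le n x) (Nat.mul_le_mul e1 e2)
        _ = (n + 1) ^ (x + 2 * (k * t)) := by rw [← pow_add, ← pow_add]; ring_nf
        _ ≤ (n + 1) ^ (2 * x) := Nat.pow_le_pow_right (by omega) (by omega)
    have h2 : ((n : ℝ) + 1) ^ (2 * x) = Real.exp (2 * x * Real.log (n + 1)) := by
      rw [show (2 : ℝ) * x = ((2 * x : ℕ) : ℝ) by push_cast; ring, Real.exp_nat_mul,
        Real.exp_log (by positivity)]
    calc (index.card : ℝ) ≤ ((n : ℝ) + 1) ^ (2 * x) := by exact_mod_cast h1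
      _ ≤ Real.exp n := by rw [h2, Real.exp_le_exp]; exact hx
  refine (pr_le_card_mul hq0.le hq1 index (fun a E => (a.1.card ≤ x ∧
    (∀ i j, i ≠ j → Disjoint (a.2.2 i) (a.2.2 j)) ∧ δ < ∑ i ∈ a.2.1, q ^ (a.2.2 i).card) ∧
    ∀ i ∈ a.2.1, (n * q ^ (a.2.2 i).card) / 4 ≤ ((freeL E (a.2.2 i) ∩ a.1).card : ℝ))
    (b := Real.exp (-(2 * n))) ?_ hcard (Real.exp_pos _).le ?_).trans ?_
  · intro E hE
    push Not at hE
    obtain ⟨X, J, S, h1, h2, h3, h4, h5⟩ := hE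
    refine ⟨(X, J, S), ?_, ⟨h1, h3, h5⟩, h4⟩
    simp only [index, mem_product, mem_filter, mem_univ, true_and, Fintype.mem_piFinset]
    exact ⟨h1, h2⟩
  · rintro ⟨X, J, S⟩ -
    by_cases hS : X.card ≤ x ∧ (∀ i j, i ≠ j → Disjoint (S i) (S j)) ∧
      δ < ∑ i ∈ J, q ^ (S i).card
    swap
    · refine le_trans (le_of_eq ?_) (Real.exp_pos _).le
      simp only [pr, expect]
      refine Finset.sum_eq_zero fun E _ => ?_
      rw [if_neg fun h => hS h.1, mul_zero]
    obtain ⟨hX, hdisj, hσ⟩ := hS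
    set σ := ∑ i ∈ J, q ^ (S i).card with hσdef
    -- so large that the tail bound beats the number `exp n` of choices of `X`, `J` and `S`
    set a := 4 + 8 / δ with ha
    have ha0 : 0 < a := by positivity
    let B : Fin n × Fin k → Finset (Fin n × Fin n) := fun b => block (Equiv.refl _) b.1 (S b.2)
    have hB : ((X ×ˢ J : Finset (Fin n × Fin k)) : Set (Fin n × Fin k)).PairwiseDisjoint B := by
      rintro ⟨v, i⟩ _ ⟨w, j⟩ _ hne
      refine disjoint_block_block _ ?_
      by_cases hvw : v = w
      · refine Or.inr (hdisj i j ?_)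
        rintro rfl
        exact hne (by rw [hvw])
      · exact Or.inl hvw
    refine (pr_mono hq0.le hq1 fun E hE => ?_).trans ((pr_avoided_le hq0.le hq1 (X ×ˢ J) B hB a
      (n * σ / 4)).trans ?_)
    · have h1 : ((((X ×ˢ J).filter fun b => Disjoint E (B b)).card : ℕ) : ℝ) =
          ∑ i ∈ J, ((freeL E (S i) ∩ X).card : ℝ) := by
        rw [Finset.card_filter, Finset.sum_product_right]
        push_cast
        refine Finset.sum_congr rfl fun i _ => ?_
        rw [freeL_eq_filter, Finset.inter_comm, ← Finset.filter_mem_eq_inter, Finset.card_filter]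
        push_cast
        simp [B]
      have h2 := Finset.sum_le_sum hE.2
      dsimp only at h2
      rw [← h1, ← Finset.sum_div, ← Finset.mul_sum] at h2
      exact mul_nonneg ha0.le (by linarith)
    · rw [Real.exp_le_exp, Finset.sum_product]
      simp only [B, card_block]
      rw [Finset.sum_const, nsmul_eq_mul, ← hσdef]
      have hσ0 : 0 < σ := hδ.trans hσ
      have h1 : (Real.exp a - 1) * (X.card * σ) ≤ n * σ := by
        have e1 : (X.card : ℝ) ≤ x := by exact_mod_cast hX
        calc (Real.exp a - 1) * (X.card * σ) ≤ Real.exp a * (x * σ) := by gcongr; linarith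
          _ = x * Real.exp a * σ := by ring
          _ ≤ n * σ := by gcongr
      have h2 : -a * (n * σ / 4) + n * σ = -(2 * n) * (σ / δ) := by
        rw [ha]
        field_simp
        ring
      have h3 : 1 ≤ σ / δ := by rw [le_div_iff₀ hδ]; linarith
      nlinarith
  · rw [← Real.exp_add, show (n : ℝ) + -(2 * n) = -n by ring, Real.exp_neg, one_div]
    refine inv_anti₀ (by positivity) ?_
    have h3 : Real.exp (n : ℝ) = Real.exp (n / 2) * Real.exp (n / 2) := by
      rw [← Real.exp_add]; ring_nf
    have h4 : (n : ℝ) ≤ Real.exp (n / 2) := by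
      have := Real.quadratic_le_exp_of_nonneg (show (0 : ℝ) ≤ n / 2 by linarith)
      nlinarith [sq_nonneg ((n : ℝ) - 2)]
    rw [h3, sq]
    gcongr

theorem pr_not_pseudorandom_le (hn : 2 ≤ n) (hq0 : 0 < q) (hq1 : q < 1) (ht : 1 ≤ t) (hδ : 0 < δ)
    (htn : t ≤ n) (htq : 100 * (t * Real.log n) ≤ n * q ^ t)
    (hkx : 2 * (k * t) ≤ x) (hx : 2 * x * Real.log (n + 1) ≤ n)
    (hxδ : x * Real.exp (4 + 8 / δ) ≤ n) :
    pr q (fun E : Finset (Fin n × Fin n) => ¬ Pseudorandom E q k t x δ (discBound n q)) ≤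
      9 / n ^ 2 := by
  refine (pr_or_le hq0.le hq1.le (fun E hE => ?_)).trans ((add_le_add
    (pr_not_upper_le hn hq0 hq1.le htq) ((pr_or_le hq0.le hq1.le fun E hE => hE).trans (add_le_add
    (pr_not_lower_le hn hq0 hq1.le htq) ((pr_or_le hq0.le hq1.le fun E hE => hE).trans (add_le_add
    (pr_not_block_le hn hq0 hq1.le ht hδ hkx hx hxδ) (pr_not_disc_le hn hq0 hq1 htn)))))).trans
    (le_of_eq (by ring)))
  by_contra hcon
  rw [not_or, not_or, not_or, not_not, not_not, not_not, not_not] at hcon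
  exact hE ⟨hcon.1, hcon.2.1, hcon.2.2.1, hcon.2.2.2⟩

end RandomBipartite

/-! ### Breaker wins with high probability -/

namespace RandomBipartite

open Finset ColoringGame

/-- The total loss of potential is a geometric series, dominated by the last steps. -/
theorem loss_sum_le {n k t : ℕ} {q M z : ℝ} (hn : 2 ≤ n) (hq0 : 0 < q) (hq1 : q < 1) (ht : 1 ≤ t)
    (hM0 : 0 < M) (hM : M * Real.log n ≤ (1 - q) * (n * q ^ t)) (hz : k * q ^ t ≤ z) :
    k * ∑ r ∈ range t, q ^ (t - 1 - r) * discBound n q r ≤ 32 * z * n / (q * √M) := by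
  have hnR : (2 : ℝ) ≤ n := by exact_mod_cast hn
  have hlog : 0 < Real.log n := Real.log_pos (by linarith)
  have hp : 0 < 1 - q := by linarith
  set w := √q with hw
  have hw0 : 0 < w := Real.sqrt_pos.2 hq0
  have hw2 : w ^ 2 = q := Real.sq_sqrt hq0.le
  have hw1 : w < 1 := by nlinarith
  set Y := 256 / q * (1 - q) * n * Real.log n with hY
  have hY0 : 0 ≤ Y := by positivity
  have hdisc : ∀ r, discBound n q r = √Y * w ^ r := by
    intro r
    rw [discBound, ← hY, Real.sqrt_mul hY0]
    congr 1
    rw [← hw2, ← pow_mul, mul_comm, pow_mul, Real.sqrt_sq (by positivity)]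
  have hgeom : ∑ r ∈ range t, w ^ r ≤ 2 / (1 - q) := by
    rw [le_div_iff₀ hp]
    have h1 : (∑ r ∈ range t, w ^ r) * (1 - w) = 1 - w ^ t := geom_sum_mul_neg w t
    have h2 : 0 ≤ w ^ t := by positivity
    have h3 : 1 - q = (1 - w) * (1 + w) := by rw [← hw2]; ring
    rw [h3, ← mul_assoc, h1]
    nlinarith
  have hsum : ∑ r ∈ range t, q ^ (t - 1 - r) * discBound n q r =
      √Y * (w ^ (t - 1) * ∑ r ∈ range t, w ^ r) := by
    rw [← Finset.sum_range_reflect, Finset.mul_sum, Finset.mul_sum]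
    refine Finset.sum_congr rfl fun r hr => ?_
    have hr' := mem_range.1 hr
    rw [hdisc, ← hw2, ← pow_mul, mul_left_comm, ← pow_add, ← pow_add]
    congr 2
    omega
  have hsqrt : √Y ≤ 16 * (1 - q) * n * w ^ t / (w * √M) := by
    refine Real.sqrt_le_iff.2 ⟨by positivity, ?_⟩
    have h1 : (16 * (1 - q) * n * w ^ t / (w * √M)) ^ 2 =
        256 / q * (1 - q) * n * ((1 - q) * (n * q ^ t) / M) := by
      rw [div_pow, mul_pow, mul_pow, mul_pow, mul_pow, ← pow_mul, mul_comm t 2, pow_mul, hw2,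
        Real.sq_sqrt hM0.le]
      field_simp
      norm_num
    rw [h1, hY]
    gcongr
    rw [le_div_iff₀ hM0]
    linarith
  have hk : (k : ℝ) ≤ z / q ^ t := by rwa [le_div_iff₀ (by positivity)]
  have hwt : w ^ (t - 1) = w ^ t / w := by
    rw [eq_div_iff hw0.ne', ← pow_succ]
    congr 1
    omega
  rw [hsum]
  calc (k : ℝ) * (√Y * (w ^ (t - 1) * ∑ r ∈ range t, w ^ r))
      ≤ z / q ^ t * (16 * (1 - q) * n * w ^ t / (w * √M) * (w ^ (t - 1) * (2 / (1 - q)))) := by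
        have hS : 0 ≤ ∑ r ∈ range t, w ^ r := Finset.sum_nonneg fun r _ => (pow_pos hw0 r).le
        have hW : 0 ≤ w ^ (t - 1) := (pow_pos hw0 _).le
        exact mul_le_mul hk (mul_le_mul hsqrt (mul_le_mul_of_nonneg_left hgeom hW)
          (mul_nonneg hW hS) ((Real.sqrt_nonneg _).trans hsqrt))
          (mul_nonneg (Real.sqrt_nonneg _) (mul_nonneg hW hS)) ((Nat.cast_nonneg k).trans hk)
    _ = 32 * z * n / (w ^ 2 * √M) := by
        have hqt : q ^ t = w ^ t * w ^ t := by rw [← hw2, ← pow_mul, two_mul, pow_add]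
        have hW : w ^ t ≠ 0 := pow_ne_zero _ hw0.ne'
        have hM' : √M ≠ 0 := (Real.sqrt_pos.2 hM0).ne'
        rw [hwt, hqt]
        generalize w ^ t = W at hW
        have := hp.ne'
        have := hw0.ne'
        field_simp
        ring
    _ = 32 * z * n / (q * √M) := by rw [hw2]

theorem exp_neg_le_one_sub_pow {u : ℝ} (hu0 : 0 ≤ u) (hu : u ≤ 1 / 2) (k : ℕ) :
    Real.exp (-(2 * (k * u))) ≤ (1 - u) ^ k := by
  have h0 : 0 < 1 - u := by linarith
  have h1 := Real.one_sub_inv_le_log_of_pos h0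
  have h2 : -(2 * u) ≤ 1 - (1 - u)⁻¹ := by
    have : (1 - u)⁻¹ ≤ 1 + 2 * u := by
      rw [inv_le_iff_one_le_mul₀ h0]
      nlinarith
    linarith
  rw [← Real.exp_log h0, ← Real.exp_nat_mul, Real.exp_le_exp]
  have h3 : (0 : ℝ) ≤ k := Nat.cast_nonneg k
  nlinarith

/-- The number `t` of vertices on which Breaker plays each color. It is chosen such that
`q ^ t` exceeds `100 * log g / g` by at most a factor `1 / q`, where `g = n * log (1 / q) / log n`.
In this way a vertex keeps on average a bounded number of available colors, while sets of `t`
vertices still have many more than `t * log n` common non-neighbors. -/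
theorem exists_target {n : ℕ} {q η g : ℝ} (hη : 0 < η) (hqη : η ≤ q) (hq1 : q < 1)
    (hn : 2 ≤ n) (hg : g = n * -Real.log q / Real.log n) (hg1 : 1 ≤ Real.log g)
    (hg2 : 200 * Real.log g ≤ η * g) :
    ∃ t : ℕ, 1 ≤ t ∧ t * -Real.log q ≤ Real.log g ∧ 100 * (t * Real.log n) ≤ n * q ^ t ∧
      q ^ t ≤ 100 * Real.log g / (η * g) ∧ q ^ t ≤ 1 / 2 ∧
      100 * Real.log n * Real.log g ≤ -Real.log q * (n * q ^ t) := by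
  have hnR : (2 : ℝ) ≤ n := by exact_mod_cast hn
  have hlog : 0 < Real.log n := Real.log_pos (by linarith)
  have hq0 : 0 < q := by linarith
  set ℓ := -Real.log q with hℓ
  have hℓ0 : 0 < ℓ := by linarith [Real.log_neg hq0 hq1]
  have hg0 : 0 < g := by rw [hg]; positivity
  set τ := 100 * Real.log g / g with hτ
  have hτ0 : 0 < τ := by positivity
  have hτη : τ ≤ η / 2 := by
    rw [hτ, div_le_iff₀ hg0]
    linarith
  have hτq : ℓ ≤ -Real.log τ := by
    rw [hℓ, neg_le_neg_iff]
    exact Real.log_le_log hτ0 (by linarith)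
  set t := ⌊-Real.log τ / ℓ⌋₊ with ht
  have ht1 : (t : ℝ) * ℓ ≤ -Real.log τ := by
    rw [← le_div_iff₀ hℓ0]
    exact Nat.floor_le (by apply div_nonneg <;> linarith)
  have ht2 : -Real.log τ < (t + 1) * ℓ := by
    rw [← div_lt_iff₀ hℓ0]
    exact Nat.lt_floor_add_one _
  have hqt : ∀ m : ℕ, q ^ m = Real.exp (-(m * ℓ)) := by
    intro m
    rw [hℓ, mul_neg, neg_neg, Real.exp_nat_mul, Real.exp_log hq0]
  have hτt : τ ≤ q ^ t := by
    rw [hqt, ← Real.log_le_iff_le_exp hτ0]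
    linarith
  have htτ : q ^ t ≤ τ / η := by
    have h1 : q ^ (t + 1) ≤ τ := by
      rw [hqt, ← Real.le_log_iff_exp_le hτ0]
      push_cast
      linarith
    rw [le_div_iff₀ hη]
    rw [pow_succ] at h1
    have : q ^ t * η ≤ q ^ t * q := by gcongr
    linarith
  have hτlog : -Real.log τ ≤ Real.log g := by
    rw [hτ, Real.log_div (by positivity) hg0.ne']
    have : 0 ≤ Real.log (100 * Real.log g) := Real.log_nonneg (by linarith)
    linarith
  have hnτ : n * τ * ℓ = 100 * Real.log n * Real.log g := by
    rw [hτ, hg]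
    field_simp
  have hkey : 100 * Real.log n * Real.log g ≤ ℓ * (n * q ^ t) := by
    rw [← hnτ]
    have : n * τ * ℓ ≤ n * q ^ t * ℓ := by gcongr
    linarith
  refine ⟨t, ?_, ht1.trans hτlog, ?_, ?_, ?_, hkey⟩
  · rw [ht, Nat.one_le_floor_iff, le_div_iff₀ hℓ0]
    linarith
  · have h1 : 100 * (t * Real.log n) * ℓ ≤ n * q ^ t * ℓ := by
      have : Real.log n * (t * ℓ) ≤ Real.log n * Real.log g := by
        gcongr
        exact ht1.trans hτlog
      linarith
    exact le_of_mul_le_mul_right h1 hℓ0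
  · rw [hτ, div_div, mul_comm g η] at htτ
    exact htτ
  · refine htτ.trans ?_
    rw [div_le_iff₀ hη]
    linarith

/-- For `k` below the claimed lower bound and `n` large, Breaker wins with `k` colors, except with
probability `9 / n ^ 2`. The claimed bound is `g / (10 * log (n * p))`, and
the hypotheses after `hkg` say that `g` and `n` exceed constants depending on `η`. -/
theorem pr_makerWins_le {n k : ℕ} {p η g z e δ : ℝ} (hη : 0 < η) (hp0 : 0 < p) (hpη : p ≤ 1 - η)
    (hz : z = 10 / η) (he : e = Real.exp (-(2 * z))) (hδ : δ = η * e / 8)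
    (hg : g = n * -Real.log (1 - p) / Real.log n) (hk : 1 ≤ k)
    (hkg : k * (10 * Real.log (n * p)) ≤ g) (hg1 : 1 ≤ Real.log g)
    (hg2 : 200 * Real.log g ≤ η * g)
    (hg3 : 128 * z / (η * e) ≤ √(100 * η * Real.log g))
    (hn1 : 7 ≤ Real.log n) (hn2 : 1 / η ≤ Real.log n) (hn3 : 4 / e ≤ Real.log n)
    (hn4 : Real.exp (4 + 8 / δ) ≤ Real.log n) (hn5 : 4 * Real.log n ≤ n) :
    pr (1 - p) (fun E : Finset (Fin n × Fin n) => MakerWins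
      (bipartiteGraph (E : Set (Fin n × Fin n))) .maker
      (fun _ => none : Position (Fin n ⊕ Fin n) k)) ≤ 9 / n ^ 2 := by
  set q := 1 - p with hq
  have hqη : η ≤ q := by linarith
  have hq0 : 0 < q := by linarith
  have hq1 : q < 1 := by linarith
  have hpq : p = 1 - q := by rw [hq]; ring
  have hnR : (28 : ℝ) ≤ n := by linarith
  have hn : 2 ≤ n := by
    have : (2 : ℝ) ≤ n := by linarith
    exact_mod_cast this
  have hkR : (1 : ℝ) ≤ k := by exact_mod_cast hk
  have hlog : 0 < Real.log n := by linarith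
  obtain ⟨t, ht, htg, htq, hqt, hqt2, hqt3⟩ := exists_target hη hqη hq1 hn hg hg1 hg2
  set ℓ := -Real.log q with hℓ
  have hℓ1 : p ≤ ℓ := le_neg_log_one_sub (by linarith)
  have hℓ0 : 0 < ℓ := by linarith
  have hℓ2 : η * ℓ ≤ p := by
    have := neg_log_one_sub_le hη hp0.le hpη
    rw [le_div_iff₀ hη] at this
    linarith
  have hg0 : 0 < g := by rw [hg]; positivity
  set L := Real.log (n * p) with hL
  have hgn : g * Real.log n = n * ℓ := by rw [hg]; field_simp
  have hgL : Real.log g ≤ L := by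
    refine Real.log_le_log hg0 ?_
    have h1 : g * 1 ≤ g * (η * Real.log n) := by
      gcongr
      rw [div_le_iff₀ hη] at hn2
      linarith
    have h2 : g * (η * Real.log n) = n * (η * ℓ) := by
      calc g * (η * Real.log n) = η * (g * Real.log n) := by ring
        _ = n * (η * ℓ) := by rw [hgn]; ring
    have h3 : (n : ℝ) * (η * ℓ) ≤ n * p := by gcongr
    linarith
  have hL0 : 1 ≤ L := hg1.trans hgL
  have hz0 : 0 < z := by rw [hz]; positivity
  have he0 : 0 < e := by rw [he]; positivity
  have hδ0 : 0 < δ := by rw [hδ]; positivity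
  have hkt : (k * t : ℝ) * Real.log n ≤ n / 10 := by
    have h1 : (k : ℝ) * (t * ℓ) ≤ k * L := by gcongr; exact htg.trans hgL
    have h2 : (k * t : ℝ) * Real.log n * ℓ ≤ n / 10 * ℓ := by
      have : (k : ℝ) * (t * ℓ) * Real.log n ≤ g / 10 * Real.log n := by
        gcongr
        linarith
      linarith
    exact le_of_mul_le_mul_right h2 hℓ0
  have hkqt : k * q ^ t ≤ z := by
    have h1 : (k : ℝ) * q ^ t ≤ k * (100 * Real.log g / (η * g)) := by gcongr
    refine h1.trans ?_
    rw [hz, mul_div_assoc', div_le_div_iff₀ (by positivity) hη]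
    have h2 : k * (10 * Real.log g) ≤ g := le_trans (by gcongr) hkg
    have h3 : 10 * η * (k * (10 * Real.log g)) ≤ 10 * η * g := by gcongr
    linarith
  have hM : 100 * η * Real.log g * Real.log n ≤ (1 - q) * (n * q ^ t) := by
    have h1 : η * (100 * Real.log n * Real.log g) ≤ η * (ℓ * (n * q ^ t)) := by gcongr
    have h2 : η * ℓ * (n * q ^ t) ≤ p * (n * q ^ t) := by gcongr
    rw [← hpq]
    linarith
  have hloss := loss_sum_le hn hq0 hq1 ht (by positivity) hM hkqt
  have hloss2 : 32 * z * n / (q * √(100 * η * Real.log g)) ≤ n * e / 4 := by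
    have h1 : 128 * z / e ≤ q * √(100 * η * Real.log g) := by
      have : η * (128 * z / (η * e)) ≤ q * √(100 * η * Real.log g) := by gcongr
      refine le_trans (le_of_eq ?_) this
      field_simp
    have h2 : 0 < 128 * z / e := by positivity
    calc 32 * z * n / (q * √(100 * η * Real.log g)) ≤ 32 * z * n / (128 * z / e) := by gcongr
      _ = n * e / 4 := by field_simp; norm_num
  have hkt0 : (0 : ℝ) ≤ k * t := by positivity
  have htn : t ≤ n := by
    have h1 : (n : ℝ) * q ^ t ≤ n * 1 := by gcongr; exact pow_le_one₀ hq0.le hq1.le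
    have h2 : (t : ℝ) * 1 ≤ t * Real.log n := by gcongr; linarith
    have h3 : (0 : ℝ) ≤ t := Nat.cast_nonneg t
    exact_mod_cast (show (t : ℝ) ≤ n by linarith)
  have hpow : n * e ≤ n * (1 - q ^ t) ^ k := by
    gcongr
    refine le_trans ?_ (exp_neg_le_one_sub_pow (by positivity) hqt2 k)
    rw [he, Real.exp_le_exp]
    linarith
  have hfin : 2 * (n * (δ / q)) + (2 * (k * t) + 1) +
      k * ∑ r ∈ range t, q ^ (t - 1 - r) * discBound n q r < n * (1 - q ^ t) ^ k := by
    have h1 : 2 * (n * (δ / q)) ≤ n * e / 4 := by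
      have : δ / q ≤ δ / η := by gcongr
      have h2 : δ / η = e / 8 := by rw [hδ]; field_simp
      have h3 : (n : ℝ) * (δ / q) ≤ n * (e / 8) := by rw [← h2]; gcongr
      linarith
    have h4 : (2 * (k * t) + 1 : ℝ) ≤ n * e / 4 := by
      rw [div_le_iff₀ he0] at hn3
      have h5 : (k * t : ℝ) * 4 ≤ n / 10 * e := by
        calc (k * t : ℝ) * 4 ≤ k * t * (Real.log n * e) := by gcongr
          _ = k * t * Real.log n * e := by ring
          _ ≤ n / 10 * e := by gcongr
      have h6 : 4 * Real.log n * e ≤ n * e := by gcongr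
      linarith
    have h7 : 0 < n * e := by positivity
    linarith
  refine (pr_mono hq0.le hq1.le ?_).trans (pr_not_pseudorandom_le (k := k) (t := t)
    (x := 2 * (k * t) + 1) (δ := δ) hn hq0 hq1 ht hδ0 htn htq (by omega) ?_ ?_)
  · intro E hwin hE
    exact not_makerWins_of_pseudorandom hE hq0 hq1.le le_rfl hδ0.le
      (fun r => Real.sqrt_nonneg _) hfin hwin
  · push_cast
    have h1 : Real.log (n + 1) ≤ Real.log n + 1 / 10 := by
      have e1 : Real.log (n + 1) = Real.log n + Real.log (1 + 1 / n) := by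
        rw [← Real.log_mul (by positivity) (by positivity)]
        congr 1
        field_simp
      have e2 := Real.log_le_sub_one_of_pos (show (0 : ℝ) < 1 + 1 / n by positivity)
      have e3 : 1 / (n : ℝ) ≤ 1 / 10 := by gcongr; linarith
      linarith
    have h2 : 2 * (2 * ((k : ℝ) * t) + 1) * Real.log (n + 1) ≤
        2 * (2 * ((k : ℝ) * t) + 1) * (11 / 10 * Real.log n) := by
      gcongr
      linarith
    linarith
  · push_cast
    have h1 : (2 * ((k : ℝ) * t) + 1) * Real.exp (4 + 8 / δ) ≤
        (2 * ((k : ℝ) * t) + 1) * Real.log n := by gcongr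
    linarith

/-- With fewer than `n / (10 * log n * log_b (n * p))` colors Breaker wins with high probability. -/
theorem whp_le_gameChromaticNumber {η : ℝ} (hη : 0 < η) (p : ℕ → unitInterval)
    (hp : ∀ᶠ n : ℕ in atTop, 2 / (n : ℝ) ≤ (p n : ℝ) ∧ (p n : ℝ) ≤ 1 - η) :
    Whp p (fun n G => (n : ℝ) / (10 * Real.log n * logbnp n (p n)) ≤
      (gameChromaticNumber G : ℝ)) := by
  refine whp_of_pr_not_le p _ fun ε hε => ?_
  set z := 10 / η with hz
  set e := Real.exp (-(2 * z)) with he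
  set δ := η * e / 8 with hδ
  have he0 : 0 < e := Real.exp_pos _
  have hgood : ∀ᶠ g : ℝ in atTop, 1 ≤ Real.log g ∧ 200 * Real.log g ≤ η * g ∧
      128 * z / (η * e) ≤ √(100 * η * Real.log g) := by
    have h1 := Real.tendsto_log_atTop
    have h2 : Tendsto (fun g => √(100 * η * Real.log g)) atTop atTop :=
      Real.tendsto_sqrt_atTop.comp (h1.const_mul_atTop (by positivity))
    have h3 := Real.isLittleO_log_id_atTop.bound (show (0 : ℝ) < η / 200 by positivity)
    filter_upwards [h1.eventually_ge_atTop 1, h3, h2.eventually_ge_atTop (128 * z / (η * e)),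
      eventually_ge_atTop 0] with g g1 g2 g3 g0
    refine ⟨g1, ?_, g3⟩
    rw [Real.norm_of_nonneg (by linarith), id, Real.norm_of_nonneg g0] at g2
    linarith
  obtain ⟨G, hG⟩ := eventually_atTop.1 hgood
  have hlog : Tendsto (fun n : ℕ => Real.log n) atTop atTop :=
    Real.tendsto_log_atTop.comp tendsto_natCast_atTop_atTop
  have hloglog : Tendsto (fun n : ℕ => Real.log (η * Real.log n)) atTop atTop :=
    Real.tendsto_log_atTop.comp (hlog.const_mul_atTop hη)
  have hlin : ∀ᶠ n : ℕ in atTop, 4 * Real.log n ≤ n := by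
    have h3 := tendsto_natCast_atTop_atTop.eventually
      (Real.isLittleO_log_id_atTop.bound (show (0 : ℝ) < 1 / 4 by norm_num))
    filter_upwards [h3, hlog.eventually_ge_atTop 0] with n h h0
    rw [Real.norm_of_nonneg h0, id, Real.norm_of_nonneg (Nat.cast_nonneg n)] at h
    linarith
  have hsmall : ∀ᶠ n : ℕ in atTop, 9 / (n : ℝ) ≤ ε :=
    (tendsto_const_div_atTop_nhds_zero_nat 9).eventually_le_const hε
  filter_upwards [hp, hlog.eventually_ge_atTop 7, hlog.eventually_ge_atTop (1 / η),
    hlog.eventually_ge_atTop (4 / e), hlog.eventually_ge_atTop (Real.exp (4 + 8 / δ)), hlin,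
    hloglog.eventually_ge_atTop (max G 0), hsmall] with n hpn hn1 hn2 hn3 hn4 hn5 hn6 hn7
  have hnR : (28 : ℝ) ≤ n := by linarith
  have hlogn : 0 < Real.log n := by linarith
  have hp0 : 0 < (p n : ℝ) := lt_of_lt_of_le (by positivity) hpn.1
  have hp1 : (p n : ℝ) < 1 := by linarith
  have hq0 : 0 ≤ 1 - (p n : ℝ) := by linarith
  have hq1 : 1 - (p n : ℝ) ≤ 1 := by linarith
  have hℓ1 := le_neg_log_one_sub hp1
  have hℓ2 := neg_log_one_sub_le hη hp0.le hpn.2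
  set ℓ := -Real.log (1 - (p n : ℝ)) with hℓ
  have hℓ0 : 0 < ℓ := by linarith
  have hnp : 2 ≤ n * (p n : ℝ) := by
    have := hpn.1
    rw [div_le_iff₀ (by linarith)] at this
    linarith
  set L := Real.log (n * (p n : ℝ)) with hL
  have hL0 : 1 / 2 < L := by
    have := Real.log_le_log (by norm_num) hnp
    linarith [Real.log_two_gt_d9]
  set g := n * ℓ / Real.log n with hg
  have hK : (n : ℝ) / (10 * Real.log n * logbnp n (p n)) = g / (10 * L) := by
    rw [logbnp_eq, ← hL, ← hℓ, hg]
    field_simp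
  rw [hK]
  have hgn : g / (10 * L) ≤ n := by
    rw [div_le_iff₀ (by linarith), hg, div_le_iff₀ hlogn]
    have h1 : (n : ℝ) * ℓ ≤ n * (p n / η) := by gcongr
    have h2 : (p n : ℝ) / η ≤ Real.log n := by
      refine le_trans ?_ hn2
      gcongr
    have h3 : (n : ℝ) * ℓ ≤ n * Real.log n := h1.trans (by gcongr)
    have h4 : (n : ℝ) * Real.log n * 1 ≤ n * Real.log n * (10 * L) := by
      gcongr
      linarith
    linarith
  have hbad : ∀ k ∈ range n, pr (1 - (p n : ℝ)) (fun E : Finset (Fin n × Fin n) =>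
      1 ≤ k ∧ (k : ℝ) < g / (10 * L) ∧ MakerWins (bipartiteGraph (E : Set (Fin n × Fin n))) .maker
        (fun _ => none : Position (Fin n ⊕ Fin n) k)) ≤ 9 / n ^ 2 := by
    intro k _
    by_cases hk : 1 ≤ k ∧ (k : ℝ) < g / (10 * L)
    swap
    · refine le_trans (le_of_eq ?_) (by positivity : (0 : ℝ) ≤ _)
      simp only [pr, expect]
      refine Finset.sum_eq_zero fun E _ => ?_
      rw [if_neg fun h => hk ⟨h.1, h.2.1⟩, mul_zero]
    obtain ⟨hk1, hk2⟩ := hk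
    rw [lt_div_iff₀ (by linarith)] at hk2
    have hkR : (1 : ℝ) ≤ k := by exact_mod_cast hk1
    have hg10 : 10 * L ≤ g := by
      have : 1 * (10 * L) ≤ k * (10 * L) := by gcongr
      linarith
    -- a nontrivial bound forces `g`, hence `n * p`, hence again `g`, to be large
    have hgG : G ≤ g := by
      have h1 : η * Real.log n ≤ n * p n := by
        have e1 : 1 ≤ g := by linarith
        have e2 : η * (1 * Real.log n) ≤ η * (g * Real.log n) := by gcongr
        have e3 : g * Real.log n = n * ℓ := by rw [hg]; field_simp
        have e4 : η * ℓ ≤ p n := by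
          rw [le_div_iff₀ hη] at hℓ2
          linarith
        have e5 : (n : ℝ) * (η * ℓ) ≤ n * p n := by gcongr
        rw [e3] at e2
        linarith
      have h2 := Real.log_le_log (by positivity) h1
      have h3 := (le_max_left G 0).trans hn6
      linarith
    obtain ⟨hg1, hg2, hg3⟩ := hG g hgG
    exact (pr_mono hq0 hq1 fun E h => h.2.2).trans (pr_makerWins_le hη hp0 hpn.2 hz he hδ hg hk1
      hk2.le hg1 hg2 hg3 hn1 hn2 hn3 hn4 hn5)
  refine (pr_le_card_mul hq0 hq1 (range n) _ (M := n) ?_ (by simp) (by positivity) hbad).trans ?_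
  · intro E hE
    rw [not_le] at hE
    obtain ⟨hpos, hwin⟩ := gameChromaticNumber_spec (bipartiteGraph (E : Set (Fin n × Fin n)))
    refine ⟨_, mem_range.2 ?_, hpos, hE, hwin⟩
    exact_mod_cast hE.trans_le hgn
  · refine le_trans (le_of_eq ?_) hn7
    field_simp

end RandomBipartite

theorem theorem2 :
    (∀ (η : ℝ) (_ : 0 < η) (p : ℕ → unitInterval)
      (_ : ∀ᶠ n : ℕ in atTop, 2 / (n : ℝ) ≤ (p n : ℝ) ∧ (p n : ℝ) ≤ 1 - η),
      RandomBipartite.Whp p (fun n G =>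
        (n : ℝ) / (10 * Real.log n * RandomBipartite.logbnp n (p n)) ≤
          (ColoringGame.gameChromaticNumber G : ℝ))) ∧
    (∀ (η : ℝ) (_ : 0 < η) (α : ℝ) (_ : 2 < α) (K : ℝ)
      (_ : K = max (2 * α / (α - 1)) (α / (α - 2))) (p : ℕ → unitInterval)
      (_ : ∀ᶠ n : ℕ in atTop,
        Real.log n ^ K / (n : ℝ) ≤ (p n : ℝ) ∧ (p n : ℝ) ≤ 1 - η),
      RandomBipartite.Whp p (fun n G =>
        (ColoringGame.gameChromaticNumber G : ℝ) ≤
          α * ((n : ℝ) / RandomBipartite.logbnp n (p n)))) :=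
  ⟨fun _ hη p hp => RandomBipartite.whp_le_gameChromaticNumber hη p hp,
    fun _ hη _ hα _ hK p hp => RandomBipartite.whp_gameChromaticNumber_le hη hα hK p hp⟩
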